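/- Let $n\ge 0$, $\phi=\begin{pmatrix}E&0\\0&-E\end{pmatrix}$ with $E$ the $n\times n$ unit matrix, $U(n,n)=\{g\in GL(2n,\mathbb C): g^+\phi g=\phi\}$, and $\mathbf u(n,n)=\{\mathfrak X: \mathfrak X^+\phi+\phi\mathfrak X=0\}$. Let $iH(n)$ be the real space of anti-Hermitian $n\times n$ matrices. For a subspace $z\subset\mathbb C^{2n}$ let $z^\perp$ be its orthogonal complement for $\langle v,w\rangle=v^+\phi w$. Let $\mathrm{Gr}_0$ be the Grassmannian of $n$-dimensional subspaces $z\subset\mathbb C^{2n}$ with $z=z^\perp$, and $$\mathcal N_0=\{(\mathfrak X,z)\in\mathfrak{gl}(2n,\mathbb C)\times \mathrm{Gr}_0:\ \operatorname{Im}\mathfrak X\subset z\subset\operatorname{Ker}\mathfrak X,\ -\phi\mathfrak X^+\phi=\mathfrak X\},$$ a real vector bundle over $\mathrm{Gr}_0$. Identify $U(n)\times iH(n)$ with $T^*U(n)$ by letting $(Z,\rho)$ be the covector $v\mapsto \mathrm{Tr}(\rho Z^+v)$ on $T_ZU(n)=Z\cdot iH(n)$; this is a (fibrewise linear) diffeomorphism.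 For $g=\begin{pmatrix}A&B\\C&D\end{pmatrix}\in U(n,n)$ put $$\Lambda_g(Z,\rho)=\big((AZ+B)(CZ+D)^{-1},\ (CZ+D)\rho(CZ+D)^+\big),\qquad \Sigma_g(\mathfrak X,z)=(g\mathfrak Xg^{-1},gz).$$ These are well-defined smooth actions of $U(n,n)$ on $U(n)\times iH(n)$ and on $\mathcal N_0$. (i) The map $$\mathbf I_0(Z,\rho)=\left(\begin{pmatrix}-Z\rho Z^+&Z\rho\\(Z\rho)^+&\rho\end{pmatrix},\ \{(Z\xi,\xi):\xi\in\mathbb C^n\}\right)$$ is an isomorphism of vector bundles $T^*U(n)\cong U(n)\times iH(n)\to\mathcal N_0$ over the diffeomorphism $U(n)\to \mathrm{Gr}_0$, $Z\mapsto\{(Z\xi,\xi):\xi\in\mathbb C^n\}$, and $\mathbf I_0\circ\Lambda_g=\Sigma_g\circ\mathbf I_0$ for all $g\in U(n,n)$. (ii) In the coordinates $(Z,\rho)$ the canonical one-form of $T^*U(n)$ is the (real) form $\gamma_0=\mathrm{Tr}(\rho Z^+dZ)$, and it is invariant under $\Lambda_g$ for all $g\in U(n,n)$. (iii) The form $d\gamma_0$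 is symplectic. Define Hamiltonian vector fields by $d\gamma_0(X_f,\cdot)=df$ and the Poisson bracket by $\{f,h\}=d\gamma_0(X_f,X_h)$. The smooth map $\mathbf J_0=\mathrm{pr}_1\circ\mathbf I_0:T^*U(n)\to\mathbf u(n,n)$ is $U(n,n)$-equivariant, $g\,\mathbf J_0(x)\,g^{-1}=\mathbf J_0(\Lambda_g x)$. It is a momentum map: for every $\xi\in\mathbf u(n,n)$ the velocity at $t=0$ of $t\mapsto\Lambda_{\exp(t\xi)}x$ is the Hamiltonian vector at $x$ of the function $\mathrm{Tr}(\mathbf J_0\,\xi)$. It is a Poisson map into the Lie–Poisson space $\mathbf u(n,n)\cong\mathbf u(n,n)^*$ (identified by the trace form $\mathrm{Tr}(\mathfrak X\mathfrak Y)$), i.e. $\{f\circ\mathbf J_0,h\circ\mathbf J_0\}=\{f,h\}_{L\text{-}P}\circ\mathbf J_0$ for $f,h\in C^\infty(\mathbf u(n,n),\mathbb R)$, where $\{f,h\}_{L\text{-}P}(\mathfrak X)=\mathrm{Tr}(\mathfrak X[df(\mathfrak X),dh(\mathfrak X)])$. At $\mathfrak X=\begin{pmatrix}\alpha&\beta\\\beta^+&\delta\end{pmatrix}$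 this bracket is $$\begin{aligned}\{f,h\}_{L\text{-}P}=\mathrm{Tr}\Big(&\alpha\big([\tfrac{\partial f}{\partial\alpha},\tfrac{\partial h}{\partial\alpha}]+\tfrac{\partial f}{\partial\beta}\tfrac{\partial h}{\partial\beta^+}-\tfrac{\partial h}{\partial\beta}\tfrac{\partial f}{\partial\beta^+}\big)\\ &+\beta\big(\tfrac{\partial f}{\partial\beta^+}\tfrac{\partial h}{\partial\alpha}+\tfrac{\partial f}{\partial\delta}\tfrac{\partial h}{\partial\beta^+}-\tfrac{\partial h}{\partial\beta^+}\tfrac{\partial f}{\partial\alpha}-\tfrac{\partial h}{\partial\delta}\tfrac{\partial f}{\partial\beta^+}\big)\\ &+\beta^+\big(\tfrac{\partial f}{\partial\alpha}\tfrac{\partial h}{\partial\beta}+\tfrac{\partial f}{\partial\beta}\tfrac{\partial h}{\partial\delta}-\tfrac{\partial h}{\partial\alpha}\tfrac{\partial f}{\partial\beta}-\tfrac{\partial h}{\partial\beta}\tfrac{\partial f}{\partial\delta}\big)\\ &+\delta\big([\tfrac{\partial f}{\partial\delta},\tfrac{\partial h}{\partial\delta}]+\tfrac{\partial f}{\partial\beta^+}\tfrac{\partial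 h}{\partial\beta}-\tfrac{\partial h}{\partial\beta^+}\tfrac{\partial f}{\partial\beta}\big)\Big),\end{aligned}$$ where $\frac{\partial f}{\partial\alpha},\frac{\partial f}{\partial\delta}\in iH(n)$, $\frac{\partial f}{\partial\beta^+}=(\frac{\partial f}{\partial\beta})^+$ and $df=\mathrm{Tr}\big(d\alpha\frac{\partial f}{\partial\alpha}+d\beta\frac{\partial f}{\partial\beta^+}+d\beta^+\frac{\partial f}{\partial\beta}+d\delta\frac{\partial f}{\partial\delta}\big)$. -/

import Mathlib

open scoped Matrix Matrix.Norms.Operator ContDiff Topology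

noncomputable section

namespace CotUn

/-! ### Manifolds embedded in a finite-dimensional real vector space

All manifolds below (`U(n)`, `iH(n)`, `T*U(n)`, the isotropic Grassmannian, `N₀`, `u(n,n)`) are
embedded submanifolds of spaces of matrices.  Smooth maps, smooth curves, tangent spaces and the
exterior derivative of a one-form are taken in the classical sense for embedded submanifolds. -/

/-- A set `M` with an injection into a real normed space `E`. -/
class Embedded (M : Type*) (E : outParam Type*) [NormedAddCommGroup E] [NormedSpace ℝ E] where
  emb : M → E
  inj : Function.Injective emb

section Calculus

variable {M N E F : Type*} [NormedAddCommGroup E] [NormedSpace ℝ E] [Embedded M E]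
  [NormedAddCommGroup F] [NormedSpace ℝ F] [Embedded N F]

def emb (x : M) : E := Embedded.emb x

/-- A map is smooth if it extends locally to a `C^∞` map between the ambient spaces. -/
def IsSmooth (f : M → N) : Prop :=
  ∀ x : M, ∃ V : Set E, IsOpen V ∧ emb x ∈ V ∧
    ∃ G : E → F, ContDiffOn ℝ ∞ G V ∧ ∀ y : M, emb y ∈ V → G (emb y) = emb (f y)

/-- A bijection that is smooth together with its inverse. -/
def IsDiffeo (f : M → N) : Prop :=
  ∃ h : N → M, Function.LeftInverse h f ∧ Function.RightInverse h f ∧ IsSmooth f ∧ IsSmooth h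

instance instEmbeddedProd : Embedded (M × N) (E × F) where
  emb p := (emb p.1, emb p.2)
  inj _ _ h := Prod.ext (Embedded.inj (Prod.ext_iff.1 h).1) (Embedded.inj (Prod.ext_iff.1 h).2)

/-- A smooth curve `t ↦ c(t)` in `M`. -/
structure SmoothCurve (M : Type*) {E : Type*} [NormedAddCommGroup E] [NormedSpace ℝ E]
    [Embedded M E] where
  toFun : ℝ → M
  smooth : ContDiff ℝ ∞ (fun t => emb (toFun t))

/-- The tangent space of `M` at `x`, spanned by the velocities of the smooth curves through `x`. -/
def Tan (x : M) : Submodule ℝ E :=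
  Submodule.span ℝ {v | ∃ c : SmoothCurve M, c.toFun 0 = x ∧ v = deriv (fun t => emb (c.toFun t)) 0}

theorem SmoothCurve.deriv_mem (c : SmoothCurve M) (t : ℝ) :
    deriv (fun s => emb (c.toFun s)) t ∈ Tan (c.toFun t) := by
  refine Submodule.subset_span ⟨⟨fun s => c.toFun (s + t), ?_⟩, by simp, ?_⟩
  · exact c.smooth.comp (contDiff_id.add contDiff_const)
  · simp only
    rw [deriv_comp_add_const (fun s => emb (c.toFun s)) t 0, zero_add]

/-- The velocity of a smooth curve at time `t`. -/
def SmoothCurve.vel (c : SmoothCurve M) (t : ℝ) : Tan (c.toFun t) :=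
  ⟨deriv (fun s => emb (c.toFun s)) t, c.deriv_mem t⟩

/-- A smooth two-parameter family `(s, t) ↦ σ(s, t)` of points of `M`. -/
structure SmoothSurface (M : Type*) {E : Type*} [NormedAddCommGroup E] [NormedSpace ℝ E]
    [Embedded M E] where
  toFun : ℝ → ℝ → M
  smooth : ContDiff ℝ ∞ (fun p : ℝ × ℝ => emb (toFun p.1 p.2))

def SmoothSurface.curve₁ (σ : SmoothSurface M) (t : ℝ) : SmoothCurve M where
  toFun s := σ.toFun s t
  smooth := σ.smooth.comp (contDiff_id.prodMk contDiff_const)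

def SmoothSurface.curve₂ (σ : SmoothSurface M) (s : ℝ) : SmoothCurve M where
  toFun t := σ.toFun s t
  smooth := σ.smooth.comp (contDiff_const.prodMk contDiff_id)

/-- `∂σ/∂s` -/
def SmoothSurface.vel₁ (σ : SmoothSurface M) (s t : ℝ) : Tan (σ.toFun s t) := (σ.curve₁ t).vel s

/-- `∂σ/∂t` -/
def SmoothSurface.vel₂ (σ : SmoothSurface M) (s t : ℝ) : Tan (σ.toFun s t) := (σ.curve₂ s).vel t

/-- `Ω = dγ`: for every smooth two-parameter family `σ` one has
`Ω(∂ₛσ, ∂ₜσ) = ∂ₛ(γ(∂ₜσ)) - ∂ₜ(γ(∂ₛσ))`. -/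
def IsExteriorDerivative (γ : ∀ x : M, Tan x →ₗ[ℝ] ℝ) (Ω : ∀ x : M, Tan x →ₗ[ℝ] Tan x →ₗ[ℝ] ℝ) :
    Prop :=
  ∀ σ : SmoothSurface M, ∃ a b : ℝ,
    HasDerivAt (fun s => γ (σ.toFun s 0) (σ.vel₂ s 0)) a 0 ∧
    HasDerivAt (fun t => γ (σ.toFun 0 t) (σ.vel₁ 0 t)) b 0 ∧
    Ω (σ.toFun 0 0) (σ.vel₁ 0 0) (σ.vel₂ 0 0) = a - b

/-- `V` is the value at `x` of the Hamiltonian vector field of `f`, i.e. `Ω(V, ·) = df` at `x`. -/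
def IsHamiltonianVector (Ω : ∀ x : M, Tan x →ₗ[ℝ] Tan x →ₗ[ℝ] ℝ) (f : M → ℝ) (x : M) (V : Tan x) :
    Prop :=
  ∀ (c : SmoothCurve M) (W : Tan x), c.toFun 0 = x →
    (W : E) = deriv (fun t => emb (c.toFun t)) 0 →
      HasDerivAt (fun t => f (c.toFun t)) (Ω x V W) 0

/-- `b` is the value at `x` of the Poisson bracket `{f, h} = Ω(X_f, X_h)`. -/
def IsPoissonBracket (Ω : ∀ x : M, Tan x →ₗ[ℝ] Tan x →ₗ[ℝ] ℝ) (f h : M → ℝ) (x : M) (b : ℝ) :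
    Prop :=
  ∃ V W : Tan x, IsHamiltonianVector Ω f x V ∧ IsHamiltonianVector Ω h x W ∧ Ω x V W = b

end Calculus

/-! ### Matrices -/

abbrev Mat (n : ℕ) : Type := Matrix (Fin n) (Fin n) ℂ

/-- `2n × 2n` matrices, acting on `ℂ^{2n} = ℂⁿ ⊕ ℂⁿ`. -/
abbrev Mat2 (n : ℕ) : Type := Matrix (Fin n ⊕ Fin n) (Fin n ⊕ Fin n) ℂ

abbrev Vec2 (n : ℕ) : Type := Fin n ⊕ Fin n → ℂ

/-- The unitary group `U(n)`. -/
abbrev U (n : ℕ) : Type := Matrix.unitaryGroup (Fin n) ℂ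

/-- `iH(n)`, the anti-Hermitian matrices. -/
def iH (n : ℕ) : Submodule ℝ (Mat n) where
  carrier := {a | aᴴ = -a}
  add_mem' {a b} ha hb := by
    simp only [Set.mem_ofPred_eq] at *
    rw [Matrix.conjTranspose_add, ha, hb, neg_add]
  zero_mem' := by simp
  smul_mem' r a ha := by
    simp only [Set.mem_ofPred_eq] at *
    rw [Matrix.conjTranspose_smul, ha]; simp

theorem mem_iH {n : ℕ} {a : Mat n} : a ∈ iH n ↔ aᴴ = -a := Iff.rfl

/-- The Hermitian form of signature `(n, n)`, in diagonal block form. -/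
def phi (n : ℕ) : Mat2 n := Matrix.fromBlocks 1 0 0 (-1)

theorem phi_mul_phi (n : ℕ) : phi n * phi n = 1 := by
  simp [phi, Matrix.fromBlocks_multiply]

theorem phi_conjTranspose (n : ℕ) : (phi n)ᴴ = phi n := by
  simp [phi, Matrix.fromBlocks_conjTranspose]

/-- The group `U(n,n)`, as a subgroup of `GL(2n, ℂ)`. -/
def unnGroup (n : ℕ) : Subgroup (GL (Fin n ⊕ Fin n) ℂ) where
  carrier := {g | (g : Mat2 n)ᴴ * phi n * (g : Mat2 n) = phi n}
  mul_mem' {g h} hg hh := by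
    simp only [Set.mem_ofPred_eq] at *
    rw [Units.val_mul, Matrix.conjTranspose_mul]
    calc _ = (h : Mat2 n)ᴴ * ((g : Mat2 n)ᴴ * phi n * (g : Mat2 n)) * (h : Mat2 n) := by
          simp only [mul_assoc]
      _ = _ := by rw [hg, hh]
  one_mem' := by simp
  inv_mem' {g} hg := by
    simp only [Set.mem_ofPred_eq] at *
    have h1 : (g : Mat2 n) * (g⁻¹ : GL (Fin n ⊕ Fin n) ℂ).val = 1 := Units.mul_inv g
    have h2 : ((g⁻¹ : GL (Fin n ⊕ Fin n) ℂ).val)ᴴ * (g : Mat2 n)ᴴ = 1 := by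
      rw [← Matrix.conjTranspose_mul, h1, Matrix.conjTranspose_one]
    set k := (g⁻¹ : GL (Fin n ⊕ Fin n) ℂ).val
    calc kᴴ * phi n * k = kᴴ * ((g : Mat2 n)ᴴ * phi n * (g : Mat2 n)) * k := by rw [hg]
      _ = (kᴴ * (g : Mat2 n)ᴴ) * phi n * ((g : Mat2 n) * k) := by simp only [mul_assoc]
      _ = phi n := by rw [h1, h2, one_mul, mul_one]

abbrev Unn (n : ℕ) : Type := unnGroup n

/-- The underlying matrix of an element of `U(n,n)`. -/
def Unn.mat {n : ℕ} (g : Unn n) : Mat2 n := ((g : GL (Fin n ⊕ Fin n) ℂ) : Mat2 n)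

theorem Unn.mat_spec {n : ℕ} (g : Unn n) : g.matᴴ * phi n * g.mat = phi n := g.2

theorem Unn.mat_mul_inv {n : ℕ} (g : Unn n) : g.mat * (g⁻¹).mat = 1 :=
  Units.mul_inv (g : GL (Fin n ⊕ Fin n) ℂ)

theorem Unn.inv_mul_mat {n : ℕ} (g : Unn n) : (g⁻¹).mat * g.mat = 1 :=
  Units.inv_mul (g : GL (Fin n ⊕ Fin n) ℂ)

theorem Unn.inv_mat {n : ℕ} (g : Unn n) : (g⁻¹).mat = phi n * g.matᴴ * phi n := by
  calc (g⁻¹).mat = phi n * phi n * (g⁻¹).mat := by rw [phi_mul_phi, one_mul]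
    _ = phi n * (g.matᴴ * phi n * g.mat) * (g⁻¹).mat := by rw [g.mat_spec]
    _ = phi n * g.matᴴ * phi n * (g.mat * (g⁻¹).mat) := by simp only [mul_assoc]
    _ = _ := by rw [g.mat_mul_inv, mul_one]

/-- The Lie algebra `u(n,n)`. -/
def unn (n : ℕ) : Submodule ℝ (Mat2 n) where
  carrier := {X | Xᴴ * phi n + phi n * X = 0}
  add_mem' {a b} ha hb := by
    simp only [Set.mem_ofPred_eq] at *
    rw [Matrix.conjTranspose_add, add_mul, mul_add, add_add_add_comm, ha, hb, add_zero]
  zero_mem' := by simp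
  smul_mem' r a ha := by
    simp only [Set.mem_ofPred_eq] at *
    rw [Matrix.conjTranspose_smul, star_trivial, smul_mul_assoc, mul_smul_comm, ← smul_add, ha,
      smul_zero]

theorem mem_unn {n : ℕ} {X : Mat2 n} : X ∈ unn n ↔ Xᴴ * phi n + phi n * X = 0 := Iff.rfl

/-- The exponential map `u(n,n) → U(n,n)`. -/
def expUnn {n : ℕ} (X : unn n) : Unn n :=
  ⟨⟨NormedSpace.exp (X : Mat2 n), NormedSpace.exp (-(X : Mat2 n)),
    by rw [← Matrix.exp_add_of_commute _ _ (Commute.refl (X : Mat2 n)).neg_right]; simp,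
    by rw [← Matrix.exp_add_of_commute _ _ (Commute.refl (X : Mat2 n)).neg_left]; simp⟩, by
    change (NormedSpace.exp (X : Mat2 n))ᴴ * phi n * NormedSpace.exp (X : Mat2 n) = phi n
    have hφ : phi n * phi n = 1 := phi_mul_phi n
    have hinv : (phi n)⁻¹ = phi n := Matrix.inv_eq_left_inv hφ
    have hX : (X : Mat2 n)ᴴ = phi n * (-(X : Mat2 n)) * (phi n)⁻¹ := by
      rw [hinv]
      calc (X : Mat2 n)ᴴ = (X : Mat2 n)ᴴ * phi n * phi n := by rw [mul_assoc, hφ, mul_one]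
        _ = -(phi n * X) * phi n := by rw [eq_neg_of_add_eq_zero_left (mem_unn.1 X.2)]
        _ = _ := by rw [mul_neg]
    have hu : IsUnit (phi n) := ⟨⟨phi n, phi n, hφ, hφ⟩, rfl⟩
    rw [← Matrix.exp_conjTranspose, hX, Matrix.exp_conj _ _ hu, hinv, mul_assoc (phi n * _), hφ,
      mul_one, mul_assoc, ← Matrix.exp_add_of_commute _ _ (Commute.refl (X : Mat2 n)).neg_left]
    simp⟩

instance instEmbeddedU (n : ℕ) : Embedded (U n) (Mat n) := ⟨fun Z => Z.1, Subtype.val_injective⟩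

instance instEmbeddedIH (n : ℕ) : Embedded (iH n) (Mat n) := ⟨fun a => a.1, Subtype.val_injective⟩

instance instEmbeddedUnn (n : ℕ) : Embedded (unn n) (Mat2 n) :=
  ⟨fun X => X.1, Subtype.val_injective⟩

theorem U.star_mul {n : ℕ} (Z : U n) : (Z : Mat n)ᴴ * (Z : Mat n) = 1 :=
  Matrix.mem_unitaryGroup_iff'.1 Z.2

theorem U.mul_star {n : ℕ} (Z : U n) : (Z : Mat n) * (Z : Mat n)ᴴ = 1 :=
  Matrix.mem_unitaryGroup_iff.1 Z.2

/-! ### The cotangent bundle of `U(n)` -/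

/-- `T_Z U(n) = Z · iH(n)`. -/
theorem mem_Tan_U {n : ℕ} (Z : U n) (v : Mat n) : v ∈ Tan Z ↔ (Z : Mat n)ᴴ * v ∈ iH n := by
  constructor
  · intro hv
    induction hv using Submodule.span_induction with
    | mem v hv =>
      obtain ⟨c, rfl, rfl⟩ := hv
      have hd : HasDerivAt (fun t => ((c.toFun t : U n) : Mat n))
          (deriv (fun t => emb (c.toFun t)) 0) 0 :=
        (c.smooth.differentiable (by simp)).differentiableAt.hasDerivAt
      set v := deriv (fun t => emb (c.toFun t)) 0
      have h1 : HasDerivAt (fun t => ((c.toFun t : U n) : Mat n)ᴴ) vᴴ 0 :=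
        (LinearMap.toContinuousLinearMap
          (Matrix.conjTransposeLinearEquiv (Fin n) (Fin n) ℝ ℂ).toLinearMap).hasFDerivAt.comp_hasDerivAt
          0 hd
      have h2 := h1.mul hd
      have h3 : (fun t => ((c.toFun t : U n) : Mat n)ᴴ) * (fun t => ((c.toFun t : U n) : Mat n))
          = fun _ => 1 := funext fun t => U.star_mul _
      rw [h3] at h2
      have h4 := h2.unique (hasDerivAt_const (0 : ℝ) (1 : Mat n))
      rw [mem_iH, Matrix.conjTranspose_mul, Matrix.conjTranspose_conjTranspose]
      exact eq_neg_of_add_eq_zero_left h4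
    | zero => simp
    | add x y _ _ hx hy => rw [mul_add]; exact add_mem hx hy
    | smul a x _ hx => rw [mul_smul_comm]; exact (iH n).smul_mem a hx
  · intro hv
    set τ := (Z : Mat n)ᴴ * v with hτ
    have hexp : ∀ t : ℝ, NormedSpace.exp (t • τ) ∈ Matrix.unitaryGroup (Fin n) ℂ := by
      intro t
      rw [Matrix.mem_unitaryGroup_iff', Matrix.star_eq_conjTranspose, ← Matrix.exp_conjTranspose,
        Matrix.conjTranspose_smul, mem_iH.1 hv, star_trivial, smul_neg,
        ← Matrix.exp_add_of_commute _ _ (Commute.refl (t • τ)).neg_left]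
      simp
    have hsm : ContDiff ℝ ∞ (NormedSpace.exp : Mat n → Mat n) :=
      contDiff_iff_contDiffAt.2 fun x => (NormedSpace.exp_analytic (𝕂 := ℝ) x).contDiffAt
    refine Submodule.subset_span ⟨⟨fun t => Z * ⟨NormedSpace.exp (t • τ), hexp t⟩, ?_⟩, ?_, ?_⟩
    · change ContDiff ℝ ∞ (fun t : ℝ => (Z : Mat n) * NormedSpace.exp (t • τ))
      exact contDiff_const.mul (hsm.comp (contDiff_id.smul contDiff_const))
    · refine Subtype.ext ?_
      change (Z : Mat n) * NormedSpace.exp ((0 : ℝ) • τ) = Z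
      simp
    · change v = deriv (fun t : ℝ => (Z : Mat n) * NormedSpace.exp (t • τ)) 0
      have h := (hasDerivAt_exp_smul_const (𝕂 := ℝ) τ 0).const_mul (Z : Mat n)
      refine (h.deriv.trans ?_).symm
      rw [hτ, zero_smul, NormedSpace.exp_zero, one_mul, ← mul_assoc, U.mul_star, one_mul]

/-- The total space of `T*U(n)`: pairs of a point `Z ∈ U(n)` and a covector `p : T_Z U(n) → ℝ`. -/
def CotU (n : ℕ) : Type := (Z : U n) × Module.Dual ℝ (Tan Z)

/-- The orthogonal projection of the space of matrices, with its inner product `Re Tr(a⁺b)`, onto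
`T_Z U(n)`. -/
def tanProj {n : ℕ} (Z : U n) : Mat n →ₗ[ℝ] Tan Z where
  toFun v := ⟨(1 / 2 : ℝ) • (v - Z * vᴴ * Z), by
    rw [mem_Tan_U, mul_smul_comm]
    refine (iH n).smul_mem _ ?_
    rw [mem_iH, mul_sub, ← mul_assoc, ← mul_assoc, U.star_mul, one_mul]
    simp⟩
  map_add' v w := by
    ext1
    simp only [Submodule.coe_add, Matrix.conjTranspose_add, ← smul_add, mul_add, add_mul]
    congr 1; abel
  map_smul' r v := by
    ext1
    simp only [Submodule.coe_smul, Matrix.conjTranspose_smul, star_trivial, RingHom.id_apply]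
    rw [mul_smul_comm, smul_mul_assoc, ← smul_sub, smul_comm]

theorem tanProj_apply_tan {n : ℕ} (Z : U n) (v : Tan Z) : tanProj Z v = v := by
  ext1
  change (1 / 2 : ℝ) • ((v : Mat n) - Z * (v : Mat n)ᴴ * Z) = v
  have h := mem_iH.1 ((mem_Tan_U Z v).1 v.2)
  rw [Matrix.conjTranspose_mul, Matrix.conjTranspose_conjTranspose] at h
  rw [mul_assoc, h, mul_neg, ← mul_assoc, U.mul_star, one_mul, sub_neg_eq_add, ← two_smul ℝ,
    smul_smul]
  norm_num

/-- The matrix of coordinates `ℓ(E_{jk}) + i ℓ(i E_{jk})` of a real-linear functional `ℓ`. -/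
def dualCoord {n : ℕ} (l : Module.Dual ℝ (Mat n)) : Mat n := Matrix.of fun j k =>
  (l (Matrix.single j k 1) : ℂ) + Complex.I * (l (Matrix.single j k Complex.I) : ℂ)

theorem dualCoord_injective (n : ℕ) : Function.Injective (dualCoord (n := n)) := by
  intro l m h
  have key : ∀ j k, l (Matrix.single j k 1) = m (Matrix.single j k 1) ∧
      l (Matrix.single j k Complex.I) = m (Matrix.single j k Complex.I) := by
    intro j k
    have h' := congrFun (congrFun h j) k
    simp only [dualCoord, Matrix.of_apply] at h'
    exact ⟨by simpa using congrArg Complex.re h', by simpa using congrArg Complex.im h'⟩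
  have one : ∀ j k (c : ℂ), l (Matrix.single j k c) = m (Matrix.single j k c) := by
    intro j k c
    have hc : Matrix.single j k c
        = c.re • Matrix.single j k (1 : ℂ) + c.im • Matrix.single j k Complex.I := by
      rw [Matrix.smul_single, Matrix.smul_single, ← Matrix.single_add]
      congr 1
      simp
    rw [hc, map_add, map_add, map_smul, map_smul, map_smul, map_smul, (key j k).1, (key j k).2]
  refine LinearMap.ext fun a => ?_
  rw [Matrix.matrix_eq_sum_single a]
  simp only [map_sum, one]

/-- The smooth structure of `T*U(n)`: a covector at `Z` is extended by zero to the normal space of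
`U(n)` at `Z`; this is the usual embedding of `T*U(n)` into the cotangent bundle of the space of
matrices. -/
instance instEmbeddedCotU (n : ℕ) : Embedded (CotU n) (Mat n × Mat n) where
  emb p := ((p.1 : Mat n), dualCoord (p.2.comp (tanProj p.1)))
  inj := by
    rintro ⟨Z, p⟩ ⟨W, q⟩ h
    obtain ⟨h1, h2⟩ := Prod.ext_iff.1 h
    obtain rfl : Z = W := Subtype.ext h1
    have h3 := dualCoord_injective n h2
    have : p = q := LinearMap.ext fun v => by
      have := LinearMap.congr_fun h3 (v : Mat n)
      simpa [tanProj_apply_tan] using this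
    rw [this]

/-- The differential of the bundle projection `π : T*U(n) → U(n)`. -/
def dProj {n : ℕ} (p : CotU n) : Tan p →ₗ[ℝ] Tan p.1 :=
  ((LinearMap.fst ℝ (Mat n) (Mat n)).domRestrict (Tan p)).codRestrict (Tan p.1) (by
    rintro ⟨v, hv⟩
    change v.1 ∈ Tan p.1
    induction hv using Submodule.span_induction with
    | mem v hv =>
      obtain ⟨c, rfl, rfl⟩ := hv
      refine Submodule.subset_span ⟨⟨fun t => (c.toFun t).1, c.smooth.fst⟩, rfl, ?_⟩
      have hd : HasDerivAt (fun t => emb (c.toFun t)) (deriv (fun t => emb (c.toFun t)) 0) 0 :=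
        (c.smooth.differentiable (by simp)).differentiableAt.hasDerivAt
      exact (hasFDerivAt_fst.comp_hasDerivAt 0 hd).deriv.symm
    | zero => exact zero_mem _
    | add x y _ _ hx hy => exact add_mem hx hy
    | smul a x _ hx => exact Submodule.smul_mem _ a hx)

/-- The canonical (tautological) one-form of `T*U(n)`: its value at `p` on `V` is `p(dπ V)`. -/
def canonicalForm {n : ℕ} (p : CotU n) : Tan p →ₗ[ℝ] ℝ := p.2 ∘ₗ dProj p

/-- The space `U(n) × iH(n)` of coordinates `(Z, ρ)`. -/
abbrev Phase (n : ℕ) : Type := U n × iH n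

/-- The real part of the pairing `(ρ, v) ↦ Tr(ρ Z⁺ v)`. -/
def leftPairing {n : ℕ} (Z : U n) (ρ : iH n) : Mat n →ₗ[ℝ] ℝ :=
  Complex.reLm ∘ₗ (Matrix.traceLinearMap (Fin n) ℝ ℂ) ∘ₗ
    LinearMap.mulLeft ℝ ((ρ : Mat n) * (Z : Mat n)ᴴ)

/-- The identification `U(n) × iH(n) ≅ T*U(n)` by left translation and the trace form: `(Z, ρ)`
corresponds to the covector `v ↦ Tr(ρ Z⁺ v)` at `Z`. -/
def leftTriv (n : ℕ) (x : Phase n) : CotU n := ⟨x.1, (leftPairing x.1 x.2).domRestrict (Tan x.1)⟩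

/-- The one-form `Tr(ρ Z⁺ dZ)` on `U(n) × iH(n)`. -/
def gamma0 {n : ℕ} (x : Phase n) : Tan x →ₗ[ℝ] ℝ :=
  ((leftPairing x.1 x.2) ∘ₗ LinearMap.fst ℝ (Mat n) (Mat n)).domRestrict (Tan x)

/-! ### The Grassmannian and the bundle `N₀` -/

/-- `z^⊥` with respect to `⟨v, w⟩ = v⁺ φ w`. -/
def perp {n : ℕ} (z : Submodule ℂ (Vec2 n)) : Submodule ℂ (Vec2 n) where
  carrier := {w | ∀ v ∈ z, star v ⬝ᵥ (phi n *ᵥ w) = 0}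
  add_mem' {a b} ha hb v hv := by
    rw [Matrix.mulVec_add, dotProduct_add, ha v hv, hb v hv, add_zero]
  zero_mem' v _ := by simp
  smul_mem' r a ha v hv := by rw [Matrix.mulVec_smul, dotProduct_smul, ha v hv, smul_zero]

/-- `Gr(n, ℂ^{2n})` -/
def Gr (n : ℕ) : Type := {z : Submodule ℂ (Vec2 n) // Module.finrank ℂ z = n}

/-- The matrix of the orthogonal projection of `ℂ^{2n}`, with its standard (positive definite)
Hermitian scalar product, onto `z`. -/
def projMat {n : ℕ} (z : Submodule ℂ (Vec2 n)) : Mat2 n :=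
  LinearMap.toMatrix' ((WithLp.linearEquiv 2 ℂ (Vec2 n)).toLinearMap ∘ₗ
    ((z.map (WithLp.linearEquiv 2 ℂ (Vec2 n)).symm.toLinearMap).starProjection :
      EuclideanSpace ℂ (Fin n ⊕ Fin n) →ₗ[ℂ] EuclideanSpace ℂ (Fin n ⊕ Fin n)) ∘ₗ
    (WithLp.linearEquiv 2 ℂ (Vec2 n)).symm.toLinearMap)

theorem projMat_injective (n : ℕ) : Function.Injective (projMat (n := n)) := by
  intro z w h
  have h1 := LinearMap.toMatrix'.injective h
  have h2 : (z.map (WithLp.linearEquiv 2 ℂ (Vec2 n)).symm.toLinearMap).starProjection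
      = (w.map (WithLp.linearEquiv 2 ℂ (Vec2 n)).symm.toLinearMap).starProjection := by
    ext1 v
    have := LinearMap.congr_fun h1 (WithLp.linearEquiv 2 ℂ (Vec2 n) v)
    exact WithLp.ofLp_injective 2 (by simpa using this)
  have h3 : z.map (WithLp.linearEquiv 2 ℂ (Vec2 n)).symm.toLinearMap
      = w.map (WithLp.linearEquiv 2 ℂ (Vec2 n)).symm.toLinearMap := by
    ext v
    rw [← Submodule.starProjection_eq_self_iff, ← Submodule.starProjection_eq_self_iff, h2]
  exact Submodule.map_injective_of_injective (WithLp.linearEquiv 2 ℂ (Vec2 n)).symm.injective h3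

/-- The smooth structure of the Grassmannian, through its usual embedding by orthogonal
projections. -/
instance instEmbeddedGr (n : ℕ) : Embedded (Gr n) (Mat2 n) :=
  ⟨fun z => projMat z.1, fun _ _ h => Subtype.ext (projMat_injective n h)⟩

/-- `(𝒳, z) ∈ N`, i.e. `Im 𝒳 ⊂ z ⊂ Ker 𝒳`. -/
def MemN {n : ℕ} (p : Mat2 n × Gr n) : Prop :=
  LinearMap.range p.1.mulVecLin ≤ p.2.1 ∧ p.2.1 ≤ LinearMap.ker p.1.mulVecLin

/-- The involution `I(𝒳) = -φ 𝒳⁺ φ` of `gl(2n, ℂ)`. -/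
def inv {n : ℕ} (X : Mat2 n) : Mat2 n := -(phi n * Xᴴ * phi n)

/-- The total space of `N₀`: the fixed points in `N` of `(𝒳, z) ↦ (I(𝒳), z^⊥)`. -/
def N0 (n : ℕ) : Type := {p : Mat2 n × Gr n // MemN p ∧ inv p.1 = p.1 ∧ perp p.2.1 = p.2.1}

/-- The Grassmannian of isotropic subspaces `z = z^⊥` of dimension `n`. -/
def Gr0 (n : ℕ) : Type := {z : Gr n // perp z.1 = z.1}

instance instEmbeddedN0 (n : ℕ) : Embedded (N0 n) (Mat2 n × Mat2 n) where
  emb p := (p.1.1, emb p.1.2)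
  inj _ _ h := Subtype.ext (Prod.ext (Prod.ext_iff.1 h).1 (Embedded.inj (Prod.ext_iff.1 h).2))

instance instEmbeddedGr0 (n : ℕ) : Embedded (Gr0 n) (Mat2 n) :=
  ⟨fun z => emb z.1, fun _ _ h => Subtype.ext (Embedded.inj h)⟩

/-- The bundle projection `N₀ → Gr₀`. -/
def N0.proj {n : ℕ} (p : N0 n) : Gr0 n := ⟨p.1.2, p.2.2.2⟩

/-- `pr₁(𝒳, z) = 𝒳` -/
def N0.pr₁ {n : ℕ} (p : N0 n) : Mat2 n := p.1.1

/-- The fibre of `N₀` over `z`, a real vector space of matrices. -/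
def N0.fibre {n : ℕ} (z : Gr0 n) : Submodule ℝ (Mat2 n) where
  carrier := {X | MemN (X, z.1) ∧ inv X = X}
  add_mem' {X Y} hX hY := by
    obtain ⟨⟨h1, h2⟩, h3⟩ := hX
    obtain ⟨⟨k1, k2⟩, k3⟩ := hY
    refine ⟨⟨?_, fun v hv => ?_⟩, ?_⟩
    · rintro _ ⟨v, rfl⟩
      simp only [Matrix.mulVecLin_add, LinearMap.add_apply]
      exact add_mem (h1 ⟨v, rfl⟩) (k1 ⟨v, rfl⟩)
    · have hx := h2 hv
      have hy := k2 hv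
      simp only [LinearMap.mem_ker, Matrix.mulVecLin_add, LinearMap.add_apply] at *
      rw [hx, hy, add_zero]
    · simp only [inv] at *
      rw [Matrix.conjTranspose_add, mul_add, add_mul, neg_add, h3, k3]
  zero_mem' := by
    refine ⟨⟨?_, fun v _ => ?_⟩, ?_⟩
    · rintro _ ⟨v, rfl⟩
      simp
    · simp
    · simp [inv]
  smul_mem' r X hX := by
    obtain ⟨⟨h1, h2⟩, h3⟩ := hX
    refine ⟨⟨?_, fun v hv => ?_⟩, ?_⟩
    · rintro _ ⟨v, rfl⟩
      change (r • X) *ᵥ v ∈ z.1.1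
      rw [Matrix.smul_mulVec]
      have : X *ᵥ v ∈ z.1.1 := h1 ⟨v, rfl⟩
      have := z.1.1.smul_mem (r : ℂ) this
      rwa [Complex.coe_smul] at this
    · have hx : X *ᵥ v = 0 := h2 hv
      change (r • X) *ᵥ v = 0
      rw [Matrix.smul_mulVec, hx, smul_zero]
    · simp only [inv] at *
      rw [Matrix.conjTranspose_smul, star_trivial, mul_smul_comm, smul_mul_assoc, ← smul_neg, h3]

/-- The invertible linear map `v ↦ g v` of `ℂ^{2n}`. -/
def Unn.equiv {n : ℕ} (g : Unn n) : Vec2 n ≃ₗ[ℂ] Vec2 n :=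
  LinearEquiv.ofLinearMap g.mat.mulVecLin (g⁻¹).mat.mulVecLin
    (by rw [← Matrix.mulVecLin_mul, g.mat_mul_inv, Matrix.mulVecLin_one])
    (by rw [← Matrix.mulVecLin_mul, g.inv_mul_mat, Matrix.mulVecLin_one])

theorem Unn.equiv_apply {n : ℕ} (g : Unn n) (v : Vec2 n) : g.equiv v = g.mat *ᵥ v := rfl

theorem Unn.form_invariant {n : ℕ} (g : Unn n) (v w : Vec2 n) :
    star (g.mat *ᵥ v) ⬝ᵥ (phi n *ᵥ (g.mat *ᵥ w)) = star v ⬝ᵥ (phi n *ᵥ w) := by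
  rw [Matrix.star_mulVec, ← Matrix.dotProduct_mulVec, Matrix.mulVec_mulVec, Matrix.mulVec_mulVec,
    g.mat_spec]

theorem perp_map {n : ℕ} (g : Unn n) (z : Submodule ℂ (Vec2 n)) :
    perp (z.map g.equiv.toLinearMap) = (perp z).map g.equiv.toLinearMap := by
  ext w
  obtain ⟨u, rfl⟩ := g.equiv.surjective w
  constructor
  · intro h
    refine ⟨u, fun v hv => ?_, rfl⟩
    rw [← g.form_invariant]
    exact h _ ⟨v, hv, rfl⟩
  · rintro ⟨u', hu', he⟩
    obtain rfl := g.equiv.injective he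
    rintro _ ⟨v, hv, rfl⟩
    exact (g.form_invariant v u').trans (hu' v hv)

/-- `Σ_g(𝒳, z) = (g𝒳g⁻¹, gz)` for `g ∈ U(n,n)`, as a map of `N₀`. -/
def Sig {n : ℕ} (g : Unn n) (p : N0 n) : N0 n :=
  ⟨(g.mat * p.1.1 * (g⁻¹).mat,
    ⟨p.1.2.1.map g.equiv.toLinearMap, (g.equiv.finrank_map_eq p.1.2.1).trans p.1.2.2⟩), by
    obtain ⟨⟨X, z⟩, ⟨h1, h2⟩, h3, h4⟩ := p
    change inv X = X at h3
    refine ⟨⟨?_, ?_⟩, ?_, ?_⟩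
    · rintro _ ⟨v, rfl⟩
      refine ⟨X *ᵥ ((g⁻¹).mat *ᵥ v), h1 ⟨_, rfl⟩, ?_⟩
      change g.mat *ᵥ _ = (g.mat * X * (g⁻¹).mat) *ᵥ v
      simp only [Matrix.mulVec_mulVec, mul_assoc]
    · rintro _ ⟨v, hv, rfl⟩
      change (g.mat * X * (g⁻¹).mat) *ᵥ (g.mat *ᵥ v) = 0
      have hx : X *ᵥ v = 0 := h2 hv
      rw [Matrix.mulVec_mulVec, mul_assoc, g.inv_mul_mat, mul_one, ← Matrix.mulVec_mulVec, hx,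
        Matrix.mulVec_zero]
    · change inv (g.mat * X * (g⁻¹).mat) = g.mat * X * (g⁻¹).mat
      rw [inv] at h3 ⊢
      have hk := g.inv_mat
      have hφ := phi_mul_phi n
      have hg : g.mat = phi n * ((g⁻¹).mat)ᴴ * phi n := by
        rw [hk]
        simp only [Matrix.conjTranspose_mul, Matrix.conjTranspose_conjTranspose, phi_conjTranspose]
        calc g.mat = (phi n * phi n) * g.mat * (phi n * phi n) := by rw [hφ, one_mul, mul_one]
          _ = _ := by simp only [mul_assoc]
      calc -(phi n * (g.mat * X * (g⁻¹).mat)ᴴ * phi n)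
          = -(phi n * ((g⁻¹).mat)ᴴ * 1 * Xᴴ * 1 * g.matᴴ * phi n) := by
            simp only [Matrix.conjTranspose_mul, mul_assoc, one_mul]
        _ = (phi n * ((g⁻¹).mat)ᴴ * phi n) * -(phi n * Xᴴ * phi n)
              * (phi n * g.matᴴ * phi n) := by
            rw [← hφ]
            simp only [mul_assoc, mul_neg, neg_mul]
        _ = g.mat * X * (g⁻¹).mat := by rw [h3, ← hg, ← hk]
    · change perp (z.1.map _) = z.1.map _
      exact (perp_map g z.1).trans (congrArg _ h4)⟩

/-! ### The action `Λ` and the maps `I₀`, `J₀` -/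

section Action

variable {n : ℕ}

/-- The numerator `AZ + B`, for `g` with blocks `A`, `B`, `C`, `D`. -/
def numer (g : Unn n) (Z : U n) : Mat n := g.mat.toBlocks₁₁ * Z + g.mat.toBlocks₁₂

/-- The denominator `CZ + D`. -/
def denom (g : Unn n) (Z : U n) : Mat n := g.mat.toBlocks₂₁ * Z + g.mat.toBlocks₂₂

theorem block_identities (g : Unn n) :
    (g.mat.toBlocks₁₁)ᴴ * g.mat.toBlocks₁₁ = 1 + (g.mat.toBlocks₂₁)ᴴ * g.mat.toBlocks₂₁ ∧
    (g.mat.toBlocks₁₁)ᴴ * g.mat.toBlocks₁₂ = (g.mat.toBlocks₂₁)ᴴ * g.mat.toBlocks₂₂ ∧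
    (g.mat.toBlocks₁₂)ᴴ * g.mat.toBlocks₁₁ = (g.mat.toBlocks₂₂)ᴴ * g.mat.toBlocks₂₁ ∧
    (g.mat.toBlocks₂₂)ᴴ * g.mat.toBlocks₂₂ = 1 + (g.mat.toBlocks₁₂)ᴴ * g.mat.toBlocks₁₂ := by
  have h := g.mat_spec
  rw [phi, ← Matrix.fromBlocks_toBlocks g.mat, Matrix.fromBlocks_conjTranspose,
    Matrix.fromBlocks_multiply, Matrix.fromBlocks_multiply, Matrix.fromBlocks_inj] at h
  simp only [mul_one, mul_zero, add_zero, zero_add, mul_neg, neg_mul] at h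
  obtain ⟨h1, h2, h3, h4⟩ := h
  refine ⟨?_, ?_, ?_, ?_⟩
  · rw [← h1]; abel
  · exact sub_eq_zero.1 (by rw [← h2]; abel)
  · exact sub_eq_zero.1 (by rw [← h3]; abel)
  · rw [← sub_eq_iff_eq_add, ← neg_inj, ← h4]; abel

theorem numer_star_mul (g : Unn n) (Z : U n) :
    (numer g Z)ᴴ * numer g Z = (denom g Z)ᴴ * denom g Z := by
  obtain ⟨h1, h2, h3, h4⟩ := block_identities g
  have e : ∀ P Q : Mat n, (P * (Z : Mat n) + Q)ᴴ * (P * (Z : Mat n) + Q)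
      = (Z : Mat n)ᴴ * (Pᴴ * P) * (Z : Mat n) + (Z : Mat n)ᴴ * (Pᴴ * Q) + (Qᴴ * P) * (Z : Mat n)
        + Qᴴ * Q := by
    intro P Q
    rw [Matrix.conjTranspose_add, Matrix.conjTranspose_mul]
    noncomm_ring
  rw [numer, denom, e, e, h1, h2, h3, h4, mul_add, add_mul, mul_one, U.star_mul]
  abel

open scoped ComplexOrder in
theorem denom_isUnit (g : Unn n) (Z : U n) : IsUnit (denom g Z) := by
  obtain ⟨h1, h2, h3, h4⟩ := block_identities g
  rw [← Matrix.mulVec_injective_iff_isUnit]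
  refine (injective_iff_map_eq_zero (denom g Z).mulVecLin).2 fun v hv => ?_
  replace hv : denom g Z *ᵥ v = 0 := hv
  have hN : numer g Z *ᵥ v = 0 := by
    rw [← Matrix.conjTranspose_mul_self_mulVec_eq_zero, numer_star_mul, ← Matrix.mulVec_mulVec, hv,
      Matrix.mulVec_zero]
  have key : (g.mat.toBlocks₂₂)ᴴ * denom g Z - (g.mat.toBlocks₁₂)ᴴ * numer g Z = 1 := by
    rw [numer, denom, mul_add, mul_add, ← mul_assoc, ← mul_assoc, h3, h4]
    abel
  calc v = (1 : Mat n) *ᵥ v := (Matrix.one_mulVec v).symm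
    _ = 0 := by
      rw [← key, Matrix.sub_mulVec, ← Matrix.mulVec_mulVec, ← Matrix.mulVec_mulVec, hv, hN]
      simp

/-- `Λ_g(Z, ρ) = ((AZ + B)(CZ + D)⁻¹, (CZ + D) ρ (CZ + D)⁺)` -/
def Lam (g : Unn n) (x : Phase n) : Phase n :=
  (⟨numer g x.1 * (denom g x.1)⁻¹, by
    have hu := (Matrix.isUnit_iff_isUnit_det _).1 (denom_isUnit g x.1)
    rw [Matrix.mem_unitaryGroup_iff', Matrix.star_eq_conjTranspose, Matrix.conjTranspose_mul]
    calc _ = ((denom g x.1)⁻¹)ᴴ * ((numer g x.1)ᴴ * numer g x.1) * (denom g x.1)⁻¹ := by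
          simp only [mul_assoc]
      _ = (denom g x.1 * (denom g x.1)⁻¹)ᴴ * (denom g x.1 * (denom g x.1)⁻¹) := by
          rw [numer_star_mul, Matrix.conjTranspose_mul]
          simp only [mul_assoc]
      _ = 1 := by rw [Matrix.mul_nonsing_inv _ hu]; simp⟩,
   ⟨denom g x.1 * x.2 * (denom g x.1)ᴴ, by
    have h := mem_iH.1 x.2.2
    rw [mem_iH, Matrix.conjTranspose_mul, Matrix.conjTranspose_mul,
      Matrix.conjTranspose_conjTranspose, h]
    noncomm_ring⟩)

/-- The element of `u(n,n)` with diagonal blocks `α`, `δ` and off-diagonal blocks `β`, `β⁺`. -/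
def ofBlocks (α : iH n) (β : Mat n) (δ : iH n) : unn n :=
  ⟨Matrix.fromBlocks α β βᴴ δ, by
    have h1 := mem_iH.1 α.2
    have h2 := mem_iH.1 δ.2
    rw [mem_unn, phi, Matrix.fromBlocks_conjTranspose, Matrix.fromBlocks_multiply,
      Matrix.fromBlocks_multiply, Matrix.fromBlocks_add, h1, h2, ← Matrix.fromBlocks_zero]
    simp⟩

/-- `J₀(Z, ρ)`, the matrix with blocks `-ZρZ⁺`, `Zρ`, `(Zρ)⁺`, `ρ`. -/
def J0 (x : Phase n) : unn n :=
  ofBlocks ⟨-((x.1 : Mat n) * x.2 * (x.1 : Mat n)ᴴ), by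
    have h := mem_iH.1 x.2.2
    rw [mem_iH, Matrix.conjTranspose_neg, Matrix.conjTranspose_mul, Matrix.conjTranspose_mul,
      Matrix.conjTranspose_conjTranspose, h]
    noncomm_ring⟩ ((x.1 : Mat n) * x.2) x.2

theorem J0_mulVec (x : Phase n) (v : Vec2 n) : (J0 x : Mat2 n) *ᵥ v =
    Sum.elim ((x.1 : Mat n) *ᵥ ((x.2 : Mat n) *ᵥ (v ∘ Sum.inr - (x.1 : Mat n)ᴴ *ᵥ (v ∘ Sum.inl))))
      ((x.2 : Mat n) *ᵥ (v ∘ Sum.inr - (x.1 : Mat n)ᴴ *ᵥ (v ∘ Sum.inl))) := by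
  have h := mem_iH.1 x.2.2
  have hb : ((x.1 : Mat n) * (x.2 : Mat n))ᴴ = -((x.2 : Mat n) * (x.1 : Mat n)ᴴ) := by
    rw [Matrix.conjTranspose_mul, h, neg_mul]
  simp only [J0, ofBlocks, Matrix.fromBlocks_mulVec, hb, Matrix.mulVec_sub, Matrix.mulVec_mulVec,
    Matrix.neg_mulVec, mul_assoc]
  congr 1 <;> abel

/-- The subspace of all `(Zξ, ξ)`, `ξ ∈ ℂⁿ`. -/
def graph (Z : U n) : Submodule ℂ (Vec2 n) where
  carrier := {v | ∃ ξ : Fin n → ℂ, Sum.elim ((Z : Mat n) *ᵥ ξ) ξ = v}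
  add_mem' := by
    rintro _ _ ⟨ξ, rfl⟩ ⟨η, rfl⟩
    exact ⟨ξ + η, by ext (i | i) <;> simp [Matrix.mulVec_add]⟩
  zero_mem' := ⟨0, by ext (i | i) <;> simp⟩
  smul_mem' := by
    rintro r _ ⟨ξ, rfl⟩
    exact ⟨r • ξ, by ext (i | i) <;> simp [Matrix.mulVec_smul]⟩

theorem finrank_graph (Z : U n) : Module.finrank ℂ (graph Z) = n := by
  let e : graph Z ≃ₗ[ℂ] (Fin n → ℂ) :=
    { toFun := fun v i => v.1 (Sum.inr i)
      map_add' := fun _ _ => rfl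
      map_smul' := fun _ _ => rfl
      invFun := fun ξ => ⟨Sum.elim ((Z : Mat n) *ᵥ ξ) ξ, ξ, rfl⟩
      left_inv := by rintro ⟨_, ξ, rfl⟩; rfl
      right_inv := fun _ => rfl }
  rw [e.finrank_eq, Module.finrank_fin_fun]

open scoped ComplexOrder in
theorem perp_graph (Z : U n) : perp (graph Z) = graph Z := by
  have key : ∀ (ξ : Fin n → ℂ) (w : Vec2 n),
      star (Sum.elim ((Z : Mat n) *ᵥ ξ) ξ) ⬝ᵥ (phi n *ᵥ w)
        = star ξ ⬝ᵥ ((Z : Mat n)ᴴ *ᵥ (w ∘ Sum.inl) - w ∘ Sum.inr) := by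
    intro ξ w
    have h : star (Sum.elim ((Z : Mat n) *ᵥ ξ) ξ)
        = Sum.elim (star ξ ᵥ* (Z : Mat n)ᴴ) (star ξ) := by
      rw [← Matrix.star_mulVec]
      ext (i | i) <;> rfl
    rw [h, phi, Matrix.fromBlocks_mulVec, sumElim_dotProduct_sumElim, Matrix.neg_mulVec,
      Matrix.zero_mulVec, Matrix.zero_mulVec, Matrix.one_mulVec, Matrix.one_mulVec, add_zero,
      zero_add, ← Matrix.dotProduct_mulVec, dotProduct_neg, dotProduct_sub, sub_eq_add_neg]
  ext w
  constructor
  · intro hw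
    have h0 : (Z : Mat n)ᴴ *ᵥ (w ∘ Sum.inl) - w ∘ Sum.inr = 0 := by
      rw [← dotProduct_self_star_eq_zero, dotProduct_comm, ← key]
      exact hw _ ⟨_, rfl⟩
    refine ⟨w ∘ Sum.inr, ?_⟩
    rw [← sub_eq_zero.1 h0, Matrix.mulVec_mulVec, U.mul_star, Matrix.one_mulVec, sub_eq_zero.1 h0]
    exact Sum.elim_comp_inl_inr w
  · rintro ⟨η, rfl⟩ _ ⟨ξ, rfl⟩
    rw [key, Sum.elim_comp_inl, Sum.elim_comp_inr, Matrix.mulVec_mulVec, U.star_mul,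
      Matrix.one_mulVec, sub_self, dotProduct_zero]

theorem inv_unn (X : unn n) : inv (X : Mat2 n) = X := by
  have h := eq_neg_of_add_eq_zero_left (mem_unn.1 X.2)
  rw [inv, mul_assoc, h, mul_neg, neg_neg, ← mul_assoc, phi_mul_phi, one_mul]

/-- The base map `Z ↦ {(Zξ, ξ) : ξ ∈ ℂⁿ}`, from `U(n)` to the isotropic Grassmannian. -/
def I0base (Z : U n) : Gr0 n := ⟨⟨graph Z, finrank_graph Z⟩, perp_graph Z⟩

/-- `I₀(Z, ρ)`, the pair of the matrix with blocks `-ZρZ⁺`, `Zρ`, `(Zρ)⁺`, `ρ` and of the subspace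
`{(Zξ, ξ) : ξ ∈ ℂⁿ}`. -/
def I0 (x : Phase n) : N0 n :=
  ⟨((J0 x : Mat2 n), ⟨graph x.1, finrank_graph x.1⟩), by
    refine ⟨⟨?_, ?_⟩, inv_unn _, perp_graph x.1⟩
    · rintro _ ⟨v, rfl⟩
      exact ⟨_, (J0_mulVec x v).symm⟩
    · rintro _ ⟨ξ, rfl⟩
      change (J0 x : Mat2 n) *ᵥ _ = 0
      have h0 : ξ - (x.1 : Mat n)ᴴ *ᵥ ((x.1 : Mat n) *ᵥ ξ) = 0 := by
        rw [Matrix.mulVec_mulVec, U.star_mul, Matrix.one_mulVec, sub_self]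
      rw [J0_mulVec, Sum.elim_comp_inl, Sum.elim_comp_inr, h0, Matrix.mulVec_zero,
        Matrix.mulVec_zero]
      ext (i | i) <;> rfl⟩

end Action

/-! ### The Lie-Poisson bracket of `u(n,n)` -/

section LiePoisson

variable {n : ℕ}

/-- The trace form `Tr(XY)` of `u(n,n)`, which takes real values. -/
def traceForm (n : ℕ) : LinearMap.BilinForm ℝ (unn n) :=
  LinearMap.mk₂ ℝ (fun X Y => (Matrix.trace ((X : Mat2 n) * (Y : Mat2 n))).re)
    (fun X X' Y => by simp [add_mul]) (fun r X Y => by simp)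
    (fun X Y Y' => by simp [mul_add]) (fun r X Y => by simp)

open scoped ComplexOrder in
theorem traceForm_nondegenerate (n : ℕ) : (traceForm n).Nondegenerate := by
  have hc : ∀ X : unn n, (X : Mat2 n)ᴴ ∈ unn n := by
    intro X
    have h := eq_neg_of_add_eq_zero_left (mem_unn.1 X.2)
    have hφ := phi_mul_phi n
    rw [mem_unn, Matrix.conjTranspose_conjTranspose]
    calc _ = (X : Mat2 n) * phi n + phi n * ((X : Mat2 n)ᴴ * phi n) * phi n := by
          simp only [mul_assoc, hφ, mul_one]
      _ = 0 := by
          rw [h, mul_neg, ← mul_assoc, hφ]; simp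
  have hz : ∀ X : unn n, (Matrix.trace ((X : Mat2 n) * (X : Mat2 n)ᴴ)).re = 0 → X = 0 := by
    intro X h
    have hX : Matrix.trace ((X : Mat2 n) * (X : Mat2 n)ᴴ) = 0 := by
      refine Complex.ext h ?_
      have h2 := Matrix.trace_conjTranspose ((X : Mat2 n) * (X : Mat2 n)ᴴ)
      rw [Matrix.conjTranspose_mul, Matrix.conjTranspose_conjTranspose] at h2
      exact Complex.conj_eq_iff_im.1 h2.symm
    exact Subtype.ext (Matrix.trace_mul_conjTranspose_self_eq_zero_iff.1 hX)
  constructor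
  · intro X h
    exact hz X (h ⟨_, hc X⟩)
  · intro X h
    refine hz X ?_
    rw [Matrix.trace_mul_comm]
    exact h ⟨_, hc X⟩

/-- The differential of `f` at `X`, identified with an element of `u(n,n)` through the isomorphism
`u(n,n) ≅ u(n,n)*` given by the trace form: `Tr(df(X) Y) = f'(X) Y`. -/
def grad (f : unn n → ℝ) (X : unn n) : unn n :=
  ((traceForm n).toDual (traceForm_nondegenerate n)).symm (fderiv ℝ f X).toLinearMap

/-- The Lie-Poisson bracket `{f, h}(X) = ⟨X, [df(X), dh(X)]⟩` of `u(n,n) ≅ u(n,n)*`. -/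
def liePoisson (f h : unn n → ℝ) (X : unn n) : ℝ :=
  (Matrix.trace ((X : Mat2 n) *
    ((grad f X : Mat2 n) * (grad h X : Mat2 n) - (grad h X : Mat2 n) * (grad f X : Mat2 n)))).re

/-- `fα`, `fβ`, `fβ'`, `fδ` are the partial derivatives `∂f/∂α`, `∂f/∂β`, `∂f/∂β⁺`, `∂f/∂δ` at `X`
with respect to the blocks `α, δ ∈ iH(n)` and `β` of an element of `u(n,n)`. They are the gradients
for the trace pairing: `df = Tr(dα ∂f/∂α + dβ ∂f/∂β⁺ + dβ⁺ ∂f/∂β + dδ ∂f/∂δ)`, with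
`∂f/∂β⁺ = (∂f/∂β)⁺`. -/
structure IsPartials (f : unn n → ℝ) (X : unn n) (fα fβ fβ' fδ : Mat n) : Prop where
  memα : fα ∈ iH n
  memδ : fδ ∈ iH n
  adj : fβ' = fβᴴ
  deriv : ∀ (a : iH n) (b : Mat n) (d : iH n),
    (fderiv ℝ f X (ofBlocks a b d) : ℂ)
      = Matrix.trace ((a : Mat n) * fα + b * fβ' + bᴴ * fβ + (d : Mat n) * fδ)

end LiePoisson

end CotUn

end

/-!
The graph of `Z` is spanned by the columns of the frame `Q = (Z, 1)`, and `J₀(Z, ρ) = -QρQ⁺φ`. For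
`g ∈ U(n,n)` one has `gQ = Q'(CZ + D)`, where `Q'` is the frame of `Λ_g Z`; together with
`g⁺φ = φg⁻¹` this gives the equivariance of `J₀`, hence of `I₀`, and the action laws of `Λ` follow
from those of `Σ` since `I₀` is injective. A Lagrangian subspace meets `ℂⁿ ⊕ 0` trivially, so it is
the graph of a unitary matrix, which can be read off the orthogonal projection `½QQ⁺`.

Since `Z⁺dZ = Q⁺φ dQ` and `Q⁺φQ = 0`, differentiating `gQ = Q'(CZ + D)` along a curve `g(s)` shows
that `γ₀` changes by `-Tr(J₀ g⁻¹g')`. For constant `g` this is the invariance of `γ₀`; along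
`exp(tξ)` it says that `-γ₀` evaluated on the generator of `ξ` is `Tr(J₀ ξ)`, which by Cartan's
formula is the Hamiltonian of that generator. The Hamiltonian vectors of functions `f ∘ J₀` are then
generators with `ξ = df(J₀)`, and the bracket of two such functions is the derivative of `Tr(J₀ ξ)`
along the orbit of `exp(tη)`, namely `Tr([η, J₀] ξ) = Tr(J₀ [ξ, η])`.
-/

namespace CotUn

section EmbeddedManifold

variable {M N P E F G X : Type*} [NormedAddCommGroup E] [NormedSpace ℝ E] [Embedded M E]
  [NormedAddCommGroup F] [NormedSpace ℝ F] [Embedded N F]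
  [NormedAddCommGroup G] [NormedSpace ℝ G] [Embedded P G]
  [NormedAddCommGroup X] [NormedSpace ℝ X]

theorem emb_injective : Function.Injective (emb : M → E) := Embedded.inj

theorem IsSmooth.of_contDiffOn {f : M → N} {g : E → F} {V : Set E} (hV : IsOpen V)
    (hg : ContDiffOn ℝ ∞ g V) (hMV : ∀ x : M, emb x ∈ V) (h : ∀ x, emb (f x) = g (emb x)) :
    IsSmooth f := fun x =>
  ⟨V, hV, hMV x, g, hg, fun y _ => (h y).symm⟩

theorem IsSmooth.of_contDiff {f : M → N} {g : E → F} (hg : ContDiff ℝ ∞ g)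
    (h : ∀ x, emb (f x) = g (emb x)) : IsSmooth f :=
  .of_contDiffOn isOpen_univ hg.contDiffOn (fun _ => Set.mem_univ _) h

theorem IsSmooth.comp {k : N → P} {f : M → N} (hk : IsSmooth k) (hf : IsSmooth f) :
    IsSmooth (k ∘ f) := by
  intro x
  obtain ⟨V, hV, hxV, a, ha, haf⟩ := hf x
  obtain ⟨W, hW, hxW, b, hb, hbk⟩ := hk (f x)
  refine ⟨V ∩ a ⁻¹' W, ha.continuousOn.isOpen_inter_preimage hV hW, ⟨hxV, ?_⟩, b ∘ a, ?_, ?_⟩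
  · rw [Set.mem_preimage, haf x hxV]; exact hxW
  · exact hb.comp (ha.mono Set.inter_subset_left) fun y hy => hy.2
  · rintro y ⟨hy, hy'⟩
    rw [Set.mem_preimage, haf y hy] at hy'
    rw [Function.comp_apply, haf y hy, hbk _ hy']
    rfl

theorem IsSmooth.contDiff_comp {f : M → N} (hf : IsSmooth f) {k : X → M}
    (hk : ContDiff ℝ ∞ fun p => emb (k p)) : ContDiff ℝ ∞ fun p => emb (f (k p)) := by
  refine contDiff_iff_contDiffAt.2 fun p => ?_
  obtain ⟨V, hV, hpV, g, hg, hgf⟩ := hf (k p)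
  have hgk : ContDiffAt ℝ ∞ (fun q => g (emb (k q))) p :=
    (hg.contDiffAt (hV.mem_nhds hpV)).comp p hk.contDiffAt
  refine hgk.congr_of_eventuallyEq ?_
  filter_upwards [hk.continuous.continuousAt.preimage_mem_nhds (hV.mem_nhds hpV)] with q hq
  exact (hgf _ hq).symm

theorem IsDiffeo.of_surjective {f : M → N} {g : E → F} {g' : F → E} (hg : ContDiff ℝ ∞ g)
    (hg' : ContDiff ℝ ∞ g') (h : ∀ x, emb (f x) = g (emb x)) (h' : ∀ x, g' (emb (f x)) = emb x)
    (hs : Function.Surjective f) : IsDiffeo f := by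
  have hi : Function.Injective f := fun x y hxy => emb_injective <| by rw [← h', hxy, h']
  refine ⟨Function.surjInv hs, Function.leftInverse_surjInv ⟨hi, hs⟩,
    Function.rightInverse_surjInv hs, .of_contDiff hg h, .of_contDiff hg' fun y => ?_⟩
  rw [← h' (Function.surjInv hs y), Function.surjInv_eq hs]

/-- The image of a smooth curve under a smooth map. -/
def SmoothCurve.map {f : M → N} (hf : IsSmooth f) (c : SmoothCurve M) : SmoothCurve N where
  toFun t := f (c.toFun t)
  smooth := hf.contDiff_comp c.smooth

theorem SmoothCurve.hasDerivAt (c : SmoothCurve M) (t : ℝ) :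
    HasDerivAt (fun s => emb (c.toFun s)) (c.vel t : E) t :=
  (c.smooth.differentiable (by simp)).differentiableAt.hasDerivAt

theorem SmoothCurve.mem_tan_of_hasDerivAt (c : SmoothCurve M) {v : E}
    (h : HasDerivAt (fun t => emb (c.toFun t)) v 0) : v ∈ Tan (c.toFun 0) :=
  Submodule.subset_span ⟨c, rfl, h.deriv.symm⟩

theorem SmoothCurve.hasDerivAt_fst (c : SmoothCurve (M × N)) (t : ℝ) :
    HasDerivAt (fun s => emb (c.toFun s).1) (c.vel t : E × F).1 t :=
  (ContinuousLinearMap.fst ℝ E F).hasFDerivAt.comp_hasDerivAt t (c.hasDerivAt t)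

theorem SmoothCurve.hasDerivAt_snd (c : SmoothCurve (M × N)) (t : ℝ) :
    HasDerivAt (fun s => emb (c.toFun s).2) (c.vel t : E × F).2 t :=
  (ContinuousLinearMap.snd ℝ E F).hasFDerivAt.comp_hasDerivAt t (c.hasDerivAt t)

theorem tan_le_of_forall_vel_mem {x : M} {p : Submodule ℝ E}
    (h : ∀ c : SmoothCurve M, c.toFun 0 = x → (c.vel 0 : E) ∈ p) : Tan x ≤ p := by
  refine Submodule.span_le.2 ?_
  rintro _ ⟨c, hc, rfl⟩
  exact h c hc

theorem tan_prod (x : M) (y : N) : Tan (x, y) = (Tan x).prod (Tan y) := by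
  refine le_antisymm (tan_le_of_forall_vel_mem fun c hc => ?_) ?_
  · have hv := SmoothCurve.mem_tan_of_hasDerivAt ⟨fun t => (c.toFun t).1, c.smooth.fst⟩
      (c.hasDerivAt_fst 0)
    have hw := SmoothCurve.mem_tan_of_hasDerivAt ⟨fun t => (c.toFun t).2, c.smooth.snd⟩
      (c.hasDerivAt_snd 0)
    simp only [hc] at hv hw
    exact ⟨hv, hw⟩
  · have hx : Tan x ≤ (Tan (x, y)).comap (LinearMap.inl ℝ E F) :=
      tan_le_of_forall_vel_mem fun c hc => hc ▸ SmoothCurve.mem_tan_of_hasDerivAt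
        ⟨fun t => (c.toFun t, y), c.smooth.prodMk (contDiff_const (c := emb y))⟩
        ((c.hasDerivAt 0).prodMk (hasDerivAt_const 0 (emb y)))
    have hy : Tan y ≤ (Tan (x, y)).comap (LinearMap.inr ℝ E F) :=
      tan_le_of_forall_vel_mem fun c hc => hc ▸ SmoothCurve.mem_tan_of_hasDerivAt
        ⟨fun t => (x, c.toFun t), (contDiff_const (c := emb x)).prodMk c.smooth⟩
        ((hasDerivAt_const 0 (emb x)).prodMk (c.hasDerivAt 0))
    rintro ⟨v, w⟩ ⟨hv, hw⟩
    simpa using add_mem (Submodule.mem_comap.1 (hx hv)) (Submodule.mem_comap.1 (hy hw))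

theorem exists_hasDerivAt_subtype [FiniteDimensional ℝ E] {p : Submodule ℝ E} {k : ℝ → p}
    {v : E} {t : ℝ} (h : HasDerivAt (fun s => (k s : E)) v t) :
    ∃ w : p, (w : E) = v ∧ HasDerivAt k w t := by
  obtain ⟨q, hq⟩ := p.subtype.exists_leftInverse_of_injective p.ker_subtype
  have hk : HasDerivAt k (q v) t :=
    ((LinearMap.toContinuousLinearMap q).hasFDerivAt.comp_hasDerivAt t h).congr_of_eventuallyEq
      (.of_forall fun s => (LinearMap.congr_fun hq (k s)).symm)
  exact ⟨q v, (p.subtypeL.hasFDerivAt.comp_hasDerivAt t hk).unique h, hk⟩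

theorem tan_eq_of_range_emb_eq [FiniteDimensional ℝ E] {p : Submodule ℝ E}
    (hp : Set.range (emb : M → E) = p) (x : M) : Tan x = p := by
  have hemb (y : M) : emb y ∈ p := hp.le ⟨y, rfl⟩
  refine le_antisymm (tan_le_of_forall_vel_mem fun c _ => ?_) fun v hv => ?_
  · obtain ⟨w, hw, -⟩ := exists_hasDerivAt_subtype (k := fun t => ⟨_, hemb (c.toFun t)⟩)
      (c.hasDerivAt 0)
    exact hw ▸ w.2
  · have hline (t : ℝ) : ∃ y : M, emb y = emb x + t • v :=
      hp.ge (add_mem (hemb x) (p.smul_mem t hv))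
    choose y hy using hline
    have hy₀ : y 0 = x := emb_injective (by rw [hy, zero_smul, add_zero])
    let c : SmoothCurve M := ⟨y, by
      simp only [hy]; exact contDiff_const.add (contDiff_id.smul contDiff_const)⟩
    have hc : HasDerivAt (fun t => emb (c.toFun t)) v 0 := by
      simp only [c, hy]
      simpa using ((hasDerivAt_id (0 : ℝ)).smul_const v).const_add (emb x)
    exact hy₀ ▸ c.mem_tan_of_hasDerivAt hc

theorem hasDerivAt_partial_fst {f : ℝ × ℝ → X} {f' : ℝ × ℝ →L[ℝ] X} {s t : ℝ}
    (h : HasFDerivAt f f' (s, t)) : HasDerivAt (fun s => f (s, t)) (f' (1, 0)) s :=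
  h.comp_hasDerivAt (f := fun s => (s, t)) s ((hasDerivAt_id s).prodMk (hasDerivAt_const s t))

theorem hasDerivAt_partial_snd {f : ℝ × ℝ → X} {f' : ℝ × ℝ →L[ℝ] X} {s t : ℝ}
    (h : HasFDerivAt f f' (s, t)) : HasDerivAt (fun t => f (s, t)) (f' (0, 1)) t :=
  h.comp_hasDerivAt (f := fun t => (s, t)) t ((hasDerivAt_const t s).prodMk (hasDerivAt_id t))

theorem SmoothSurface.hasDerivAt_vel₁ (σ : SmoothSurface M) (s t : ℝ) :
    HasDerivAt (fun s => emb (σ.toFun s t)) (σ.vel₁ s t : E) s :=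
  (σ.curve₁ t).hasDerivAt s

theorem SmoothSurface.hasDerivAt_vel₂ (σ : SmoothSurface M) (s t : ℝ) :
    HasDerivAt (fun t => emb (σ.toFun s t)) (σ.vel₂ s t : E) t :=
  (σ.curve₂ s).hasDerivAt t

theorem SmoothSurface.exists_mixed_partial (σ : SmoothSurface M) : ∃ m : E,
    HasDerivAt (fun s => (σ.vel₂ s 0 : E)) m 0 ∧ HasDerivAt (fun t => (σ.vel₁ 0 t : E)) m 0 := by
  set f : ℝ × ℝ → E := fun p => emb (σ.toFun p.1 p.2)
  have hdf : Differentiable ℝ f := σ.smooth.differentiable (by simp)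
  have hd₂f : HasFDerivAt (fderiv ℝ f) (fderiv ℝ (fderiv ℝ f) (0, 0)) (0, 0) :=
    ((σ.smooth.fderiv_right (by simp)).differentiable (n := ∞) (by simp) _).hasFDerivAt
  have h₁ (s t : ℝ) : (σ.vel₁ s t : E) = fderiv ℝ f (s, t) (1, 0) :=
    (σ.hasDerivAt_vel₁ s t).unique (hasDerivAt_partial_fst (hdf (s, t)).hasFDerivAt)
  have h₂ (s t : ℝ) : (σ.vel₂ s t : E) = fderiv ℝ f (s, t) (0, 1) :=
    (σ.hasDerivAt_vel₂ s t).unique (hasDerivAt_partial_snd (hdf (s, t)).hasFDerivAt)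
  have hsymm : IsSymmSndFDerivAt ℝ f (0, 0) := σ.smooth.contDiffAt.isSymmSndFDerivAt (by
    rw [minSmoothness_of_isRCLikeNormedField]; exact WithTop.coe_le_coe.2 le_top)
  refine ⟨fderiv ℝ (fderiv ℝ f) (0, 0) (1, 0) (0, 1), ?_, ?_⟩
  · simp only [h₂]
    exact ((hasDerivAt_partial_fst hd₂f).clm_apply (hasDerivAt_const 0 (0, 1))).congr_deriv
      (by simp)
  · simp only [h₁, hsymm.eq (1, 0)]
    exact ((hasDerivAt_partial_snd hd₂f).clm_apply (hasDerivAt_const 0 (1, 0))).congr_deriv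
      (by simp)

section DifferentialForm

variable {γ : ∀ x : M, Tan x →ₗ[ℝ] ℝ} {Ω Ω' : ∀ x : M, Tan x →ₗ[ℝ] Tan x →ₗ[ℝ] ℝ}

theorem oneForm_congr (γ : ∀ x : M, Tan x →ₗ[ℝ] ℝ) {x y : M} (h : x = y) {V : Tan x} {W : Tan y}
    (hVW : (V : E) = W) : γ x V = γ y W := by
  subst h
  rw [Subtype.ext hVW]

theorem twoForm_congr (Ω : ∀ x : M, Tan x →ₗ[ℝ] Tan x →ₗ[ℝ] ℝ) {x y : M} (h : x = y)
    {V W : Tan x} {V' W' : Tan y} (hV : (V : E) = V') (hW : (W : E) = W') :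
    Ω x V W = Ω y V' W' := by
  subst h
  rw [Subtype.ext hV, Subtype.ext hW]

theorem IsExteriorDerivative.unique (hΩ : IsExteriorDerivative γ Ω)
    (hΩ' : IsExteriorDerivative γ Ω')
    (hσ : ∀ (x : M) (V W : Tan x), ∃ σ : SmoothSurface M,
      σ.toFun 0 0 = x ∧ (σ.vel₁ 0 0 : E) = V ∧ (σ.vel₂ 0 0 : E) = W) :
    Ω = Ω' := by
  funext x
  refine LinearMap.ext₂ fun V W => ?_
  obtain ⟨σ, hx, hV, hW⟩ := hσ x V W
  obtain ⟨a, b, ha, hb, h⟩ := hΩ σ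
  obtain ⟨a', b', ha', hb', h'⟩ := hΩ' σ
  rw [← twoForm_congr Ω hx hV hW, ← twoForm_congr Ω' hx hV hW, h, h', ha.unique ha',
    hb.unique hb']

/-- Cartan's formula for an invariant form: `ι_X dγ = L_X γ - d(γ X) = -d(γ X)`. -/
theorem IsExteriorDerivative.isHamiltonianVector_of_invariant (hΩ : IsExteriorDerivative γ Ω)
    {ψ : ℝ → M → M} (hψ₀ : ∀ x, ψ 0 x = x)
    (hψ : ∀ c : SmoothCurve M, ContDiff ℝ ∞ fun p : ℝ × ℝ => emb (ψ p.1 (c.toFun p.2)))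
    (hγ : ∀ (s : ℝ) (c c' : SmoothCurve M), (∀ t, c'.toFun t = ψ s (c.toFun t)) →
      γ _ (c'.vel 0) = γ _ (c.vel 0))
    {V : ∀ x : M, Tan x} (hV : ∀ x, HasDerivAt (fun s => emb (ψ s x)) (V x : E) 0) (x : M) :
    IsHamiltonianVector Ω (fun y => -γ y (V y)) x (V x) := by
  rintro c W rfl hW
  let σ : SmoothSurface M := ⟨fun s t => ψ s (c.toFun t), hψ c⟩
  have hvel₁ (t : ℝ) : (σ.vel₁ 0 t : E) = V (c.toFun t) :=
    (σ.hasDerivAt_vel₁ 0 t).unique (hV _)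
  have hvel₂ : (σ.vel₂ 0 0 : E) = W := by
    have hc : HasDerivAt (fun t => emb (ψ 0 (c.toFun t))) (c.vel 0 : E) 0 := by
      simpa only [hψ₀] using c.hasDerivAt 0
    exact ((σ.hasDerivAt_vel₂ 0 0).unique hc).trans hW.symm
  obtain ⟨a, b, ha, hb, hab⟩ := hΩ σ
  have ha₀ : a = 0 := ha.unique <| (hasDerivAt_const 0 (γ _ (c.vel 0))).congr_of_eventuallyEq
    (.of_forall fun s => hγ s c (σ.curve₂ s) fun _ => rfl)
  rw [← twoForm_congr Ω (hψ₀ _) (hvel₁ 0) hvel₂, hab, ha₀, zero_sub]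
  exact (hb.congr_of_eventuallyEq
    (.of_forall fun t => oneForm_congr γ (hψ₀ _).symm (hvel₁ t).symm)).neg

end DifferentialForm

end EmbeddedManifold

section MatrixCalculus

variable {E F G : Type*} [NormedAddCommGroup E] [NormedSpace ℝ E]
  [NormedAddCommGroup F] [NormedSpace ℝ F] [NormedAddCommGroup G] [NormedSpace ℝ G]

theorem contDiff_of_isLinearMap [FiniteDimensional ℝ F] {L : F → G} (hL : IsLinearMap ℝ L) :
    ContDiff ℝ ∞ L :=
  (LinearMap.toContinuousLinearMap (hL.mk' L)).contDiff

theorem hasDerivAt_isLinearMap_comp [FiniteDimensional ℝ F] {L : F → G} (hL : IsLinearMap ℝ L)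
    {f : ℝ → F} {f' : F} {t : ℝ} (hf : HasDerivAt f f' t) :
    HasDerivAt (fun s => L (f s)) (L f') t :=
  (LinearMap.toContinuousLinearMap (hL.mk' L)).hasFDerivAt.comp_hasDerivAt t hf

variable {l m k : Type*}

theorem isLinearMap_conjTranspose :
    IsLinearMap ℝ (Matrix.conjTranspose : Matrix l m ℂ → Matrix m l ℂ) :=
  (Matrix.conjTransposeLinearEquiv l m ℝ ℂ).toLinearMap.isLinear

variable [Fintype l]

theorem isLinearMap_re_trace : IsLinearMap ℝ fun a : Matrix l l ℂ => a.trace.re :=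
  (Complex.reLm ∘ₗ Matrix.traceLinearMap l ℝ ℂ).isLinear

variable [Fintype m] [Fintype k]

theorem isBoundedBilinearMap_matrix_mul :
    IsBoundedBilinearMap ℝ fun p : Matrix l m ℂ × Matrix m k ℂ => p.1 * p.2 :=
  (mulLinearMap ℝ : Matrix l m ℂ →ₗ[ℝ] Matrix m k ℂ →ₗ[ℝ]
    Matrix l k ℂ).toContinuousBilinearMap.isBoundedBilinearMap

theorem contDiffAt_matrix_mul {f : E → Matrix l m ℂ} {g : E → Matrix m k ℂ} {x : E}
    (hf : ContDiffAt ℝ ∞ f x) (hg : ContDiffAt ℝ ∞ g x) :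
    ContDiffAt ℝ ∞ (fun y => f y * g y) x :=
  (isBoundedBilinearMap_matrix_mul (l := l) (m := m) (k := k)).contDiff.contDiffAt.comp x
    (hf.prodMk hg)

theorem contDiff_matrix_mul {f : E → Matrix l m ℂ} {g : E → Matrix m k ℂ}
    (hf : ContDiff ℝ ∞ f) (hg : ContDiff ℝ ∞ g) : ContDiff ℝ ∞ fun x => f x * g x :=
  contDiff_iff_contDiffAt.2 fun _ => contDiffAt_matrix_mul hf.contDiffAt hg.contDiffAt

theorem hasDerivAt_matrix_mul {i j : Type*} [Finite i] [Finite j] {f : ℝ → Matrix i m ℂ}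
    {g : ℝ → Matrix m j ℂ} {f' : Matrix i m ℂ} {g' : Matrix m j ℂ} {t : ℝ}
    (hf : HasDerivAt f f' t) (hg : HasDerivAt g g' t) :
    HasDerivAt (fun s => f s * g s) (f' * g t + f t * g') t := by
  cases nonempty_fintype i
  cases nonempty_fintype j
  have h := ((isBoundedBilinearMap_matrix_mul (l := i) (m := m) (k := j)).hasFDerivAt
    (f t, g t)).comp_hasDerivAt t (hf.prodMk hg)
  exact h.congr_deriv (add_comm _ _)

variable [DecidableEq l]

theorem contDiffAt_matrix_inv {a : Matrix l l ℂ} (ha : IsUnit a) :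
    ContDiffAt ℝ ∞ (fun x : Matrix l l ℂ => x⁻¹) a := by
  obtain ⟨u, rfl⟩ := ha
  exact (contDiffAt_ringInverse ℝ u).congr_of_eventuallyEq
    (.of_forall Matrix.nonsing_inv_eq_ringInverse)

theorem contDiff_matrix_exp :
    ContDiff ℝ ∞ (NormedSpace.exp : Matrix l l ℂ → Matrix l l ℂ) :=
  contDiff_iff_contDiffAt.2 fun x => (NormedSpace.exp_analytic (𝕂 := ℝ) x).contDiffAt

theorem hasDerivAt_matrix_exp_smul (a : Matrix l l ℂ) :
    HasDerivAt (fun t : ℝ => NormedSpace.exp (t • a)) a 0 :=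
  (hasDerivAt_exp_smul_const (𝕂 := ℝ) a 0).congr_deriv (by simp)

end MatrixCalculus

section Trace

variable {n : ℕ} {ι : Type*} [Fintype ι]

theorem re_trace_conjTranspose (a : Matrix ι ι ℂ) : aᴴ.trace.re = a.trace.re := by
  rw [Matrix.trace_conjTranspose, Complex.star_def, Complex.conj_re]

theorem ofReal_re_trace_mul_of_conjTranspose_eq [DecidableEq ι] {u a b : Matrix ι ι ℂ}
    (hu : u * u = 1) (ha : aᴴ = -(u * a * u)) (hb : bᴴ = -(u * b * u)) :
    ((a * b).trace.re : ℂ) = (a * b).trace := by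
  refine Complex.conj_eq_iff_re.1 ?_
  calc star (a * b).trace = (u * (b * (u * u) * a * u)).trace := by
        rw [← Matrix.trace_conjTranspose, Matrix.conjTranspose_mul, ha, hb, neg_mul_neg]
        simp only [mul_assoc]
    _ = (a * b).trace := by
        rw [Matrix.trace_mul_comm, hu, mul_one, mul_assoc, hu, mul_one, Matrix.trace_mul_comm]

theorem ofReal_re_trace_mul {a b : Mat n} (ha : a ∈ iH n) (hb : b ∈ iH n) :
    ((a * b).trace.re : ℂ) = (a * b).trace :=
  ofReal_re_trace_mul_of_conjTranspose_eq (one_mul 1) (by simpa using mem_iH.1 ha)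
    (by simpa using mem_iH.1 hb)

open scoped ComplexOrder in
theorem eq_zero_of_re_trace_mul_self {a : Mat n} (ha : a ∈ iH n) (h : (a * a).trace.re = 0) :
    a = 0 := by
  refine Matrix.trace_mul_conjTranspose_self_eq_zero_iff.1 ?_
  rw [mem_iH.1 ha, mul_neg, Matrix.trace_neg, ← ofReal_re_trace_mul ha ha, h, Complex.ofReal_zero,
    neg_zero]

theorem conjTranspose_mul_phi {X : Mat2 n} (hX : X ∈ unn n) : Xᴴ * phi n = -(phi n * X) :=
  eq_neg_of_add_eq_zero_left (mem_unn.1 hX)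

theorem conjTranspose_of_mem_unn {X : Mat2 n} (hX : X ∈ unn n) : Xᴴ = -(phi n * X * phi n) := by
  rw [← neg_mul, ← conjTranspose_mul_phi hX, mul_assoc, phi_mul_phi, mul_one]

theorem mem_unn_of_inv_eq {X : Mat2 n} (h : inv X = X) : X ∈ unn n := by
  rw [mem_unn]
  nth_rw 2 [← h]
  rw [inv, mul_neg, ← mul_assoc, ← mul_assoc, phi_mul_phi, one_mul, add_neg_cancel]

theorem ofReal_re_trace_mul_unn {X Y : Mat2 n} (hX : X ∈ unn n) (hY : Y ∈ unn n) :
    ((X * Y).trace.re : ℂ) = (X * Y).trace :=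
  ofReal_re_trace_mul_of_conjTranspose_eq (phi_mul_phi n) (conjTranspose_of_mem_unn hX)
    (conjTranspose_of_mem_unn hY)

theorem commutator_mem_unn {X Y : Mat2 n} (hX : X ∈ unn n) (hY : Y ∈ unn n) :
    X * Y - Y * X ∈ unn n := by
  rw [mem_unn, Matrix.conjTranspose_sub, Matrix.conjTranspose_mul, Matrix.conjTranspose_mul,
    sub_mul, mul_assoc, mul_assoc, conjTranspose_mul_phi hX, conjTranspose_mul_phi hY, mul_neg,
    mul_neg, ← mul_assoc, ← mul_assoc, conjTranspose_mul_phi hX, conjTranspose_mul_phi hY]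
  noncomm_ring

end Trace

section CotangentBundle

variable {n : ℕ}

theorem leftPairing_apply (Z : U n) (ρ : iH n) (v : Mat n) :
    leftPairing Z ρ v = ((ρ : Mat n) * (Z : Mat n)ᴴ * v).trace.re := rfl

theorem ofReal_leftPairing (Z : U n) (ρ : iH n) {v : Mat n} (hv : v ∈ Tan Z) :
    ((leftPairing Z ρ v : ℝ) : ℂ) = ((ρ : Mat n) * (Z : Mat n)ᴴ * v).trace := by
  rw [leftPairing_apply, mul_assoc]
  exact ofReal_re_trace_mul ρ.2 ((mem_Tan_U Z v).1 hv)

theorem leftPairing_mul_conjTranspose_mul (Z : U n) (ρ : iH n) (v : Mat n) :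
    leftPairing Z ρ ((Z : Mat n) * vᴴ * (Z : Mat n)) = -leftPairing Z ρ v := by
  have h : ((ρ : Mat n) * (vᴴ * (Z : Mat n)))ᴴ = -((Z : Mat n)ᴴ * v * (ρ : Mat n)) := by
    simp only [Matrix.conjTranspose_mul, Matrix.conjTranspose_conjTranspose, mem_iH.1 ρ.2, mul_neg]
  calc leftPairing Z ρ ((Z : Mat n) * vᴴ * (Z : Mat n))
      = ((ρ : Mat n) * ((Z : Mat n)ᴴ * (Z : Mat n)) * (vᴴ * (Z : Mat n))).trace.re := by
        simp only [leftPairing_apply, mul_assoc]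
    _ = (-((Z : Mat n)ᴴ * v * (ρ : Mat n))).trace.re := by
        rw [U.star_mul, mul_one, ← re_trace_conjTranspose, h]
    _ = -leftPairing Z ρ v := by
        rw [Matrix.trace_neg, Complex.neg_re, Matrix.trace_mul_comm, leftPairing_apply, mul_assoc]

theorem leftPairing_tanProj (Z : U n) (ρ : iH n) (v : Mat n) :
    leftPairing Z ρ (tanProj Z v) = leftPairing Z ρ v := by
  change leftPairing Z ρ ((1 / 2 : ℝ) • (v - (Z : Mat n) * vᴴ * (Z : Mat n))) = _
  rw [map_smul, map_sub, leftPairing_mul_conjTranspose_mul, smul_eq_mul]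
  ring

theorem dualCoord_re_trace (a : Mat n) (l : Module.Dual ℝ (Mat n))
    (hl : ∀ v, l v = (a * v).trace.re) : dualCoord l = aᴴ := by
  ext j k
  simp only [dualCoord, Matrix.of_apply, hl, Matrix.trace_mul_single]
  apply Complex.ext <;> simp

theorem emb_leftTriv (x : Phase n) :
    emb (leftTriv n x) = ((x.1 : Mat n), -((x.1 : Mat n) * (x.2 : Mat n))) := by
  refine Prod.ext rfl ((dualCoord_re_trace ((x.2 : Mat n) * (x.1 : Mat n)ᴴ) _
    (leftPairing_tanProj x.1 x.2)).trans ?_)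
  rw [Matrix.conjTranspose_mul, Matrix.conjTranspose_conjTranspose, mem_iH.1 x.2.2, mul_neg]

/-- Left translation `a ↦ Z a`, which identifies `iH(n)` with `T_Z U(n)`. -/
noncomputable def leftTranslation (Z : U n) : iH n ≃ₗ[ℝ] Tan Z where
  toFun a := ⟨(Z : Mat n) * a, (mem_Tan_U Z _).2 <| by
    rw [← mul_assoc, U.star_mul, one_mul]; exact a.2⟩
  map_add' _ _ := Subtype.ext (mul_add _ _ _)
  map_smul' _ _ := Subtype.ext (mul_smul_comm _ _ _)
  invFun v := ⟨(Z : Mat n)ᴴ * v, (mem_Tan_U Z v).1 v.2⟩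
  left_inv a := Subtype.ext <| by simp only [← mul_assoc, U.star_mul, one_mul]
  right_inv v := Subtype.ext <| by simp only [← mul_assoc, U.mul_star, one_mul]

theorem leftPairing_leftTranslation (Z : U n) (ρ a : iH n) :
    leftPairing Z ρ (leftTranslation Z a : Mat n) = ((ρ : Mat n) * (a : Mat n)).trace.re := by
  change ((ρ : Mat n) * (Z : Mat n)ᴴ * ((Z : Mat n) * (a : Mat n))).trace.re = _
  rw [mul_assoc, ← mul_assoc _ (Z : Mat n), U.star_mul, one_mul]

/-- The linear map `ρ ↦ Tr(ρ Z⁺ ·)` to which `leftTriv` restricts on the fibre over `Z`. -/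
noncomputable def leftTrivFibre (Z : U n) : iH n →ₗ[ℝ] Module.Dual ℝ (Tan Z) where
  toFun ρ := (leftPairing Z ρ).domRestrict (Tan Z)
  map_add' ρ σ := LinearMap.ext fun v => by
    simp only [LinearMap.domRestrict_apply, LinearMap.add_apply, leftPairing_apply,
      Submodule.coe_add, add_mul, Matrix.trace_add, Complex.add_re]
  map_smul' r ρ := LinearMap.ext fun v => by
    simp only [LinearMap.domRestrict_apply, LinearMap.smul_apply, leftPairing_apply,
      RingHom.id_apply, Submodule.coe_smul, smul_mul_assoc, Matrix.trace_smul, Complex.smul_re]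

theorem leftTrivFibre_bijective (Z : U n) : Function.Bijective (leftTrivFibre Z) := by
  have hi : Function.Injective (leftTrivFibre Z) := by
    refine (injective_iff_map_eq_zero _).2 fun ρ hρ => Subtype.ext ?_
    refine eq_zero_of_re_trace_mul_self ρ.2 ?_
    have h : leftPairing Z ρ (leftTranslation Z ρ : Mat n) = 0 :=
      LinearMap.congr_fun hρ (leftTranslation Z ρ)
    rwa [leftPairing_leftTranslation] at h
  refine ⟨hi, (LinearMap.injective_iff_surjective_of_finrank_eq_finrank ?_).1 hi⟩
  rw [Subspace.dual_finrank_eq, (leftTranslation Z).finrank_eq]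

theorem isDiffeo_leftTriv (n : ℕ) : IsDiffeo (leftTriv n) := by
  have hconj : ContDiff ℝ ∞ (Matrix.conjTranspose : Mat n → Mat n) :=
    contDiff_of_isLinearMap isLinearMap_conjTranspose
  refine IsDiffeo.of_surjective (g := fun p : Mat n × Mat n => (p.1, -(p.1 * p.2)))
    (g' := fun p : Mat n × Mat n => (p.1, -(p.1ᴴ * p.2))) ?_ ?_ emb_leftTriv
    (fun x => ?_) ?_
  · exact contDiff_fst.prodMk (contDiff_fst.mul contDiff_snd).neg
  · exact contDiff_fst.prodMk ((hconj.comp contDiff_fst).mul contDiff_snd).neg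
  · rw [emb_leftTriv]
    simp only [mul_neg, neg_neg, ← mul_assoc, U.star_mul, one_mul]
    rfl
  · rintro ⟨Z, p⟩
    obtain ⟨ρ, rfl⟩ := (leftTrivFibre_bijective Z).2 p
    exact ⟨(Z, ρ), rfl⟩

theorem gamma0_apply (x : Phase n) (V : Tan x) :
    gamma0 x V = ((x.2 : Mat n) * (x.1 : Mat n)ᴴ * (V : Mat n × Mat n).1).trace.re := rfl

theorem mem_tan_phase {x : Phase n} {v : Mat n × Mat n} :
    v ∈ Tan x ↔ (x.1 : Mat n)ᴴ * v.1 ∈ iH n ∧ v.2 ∈ iH n := by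
  rw [tan_prod, Submodule.mem_prod, mem_Tan_U, tan_eq_of_range_emb_eq (p := iH n)]
  exact Subtype.range_coe

theorem ofReal_gamma0 (x : Phase n) (V : Tan x) : ((gamma0 x V : ℝ) : ℂ) =
    ((x.2 : Mat n) * (x.1 : Mat n)ᴴ * (V : Mat n × Mat n).1).trace :=
  ofReal_leftPairing x.1 x.2 ((mem_Tan_U _ _).2 (mem_tan_phase.1 V.2).1)

theorem hasDerivAt_base (c : SmoothCurve (Phase n)) (t : ℝ) :
    HasDerivAt (fun s => ((c.toFun s).1 : Mat n)) (c.vel t : Mat n × Mat n).1 t :=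
  c.hasDerivAt_fst t

theorem canonicalForm_leftTriv (c : SmoothCurve (Phase n)) :
    ∃ c' : SmoothCurve (CotU n), (∀ t, c'.toFun t = leftTriv n (c.toFun t)) ∧
      canonicalForm (c'.toFun 0) (c'.vel 0) = gamma0 (c.toFun 0) (c.vel 0) := by
  obtain ⟨_, _, _, hs, _⟩ := isDiffeo_leftTriv n
  refine ⟨c.map hs, fun _ => rfl, congrArg (leftPairing (c.toFun 0).1 (c.toFun 0).2) ?_⟩
  exact ((ContinuousLinearMap.fst ℝ (Mat n) (Mat n)).hasFDerivAt.comp_hasDerivAt 0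
    ((c.map hs).hasDerivAt 0)).unique (hasDerivAt_base c 0)

end CotangentBundle

section Frame

variable {n : ℕ}

/-- The matrix with blocks `Z` and `1`, whose columns span the graph `{(Zξ, ξ)}` of `Z`. -/
def frame (Z : Mat n) : Matrix (Fin n ⊕ Fin n) (Fin n) ℂ := Matrix.fromRows Z 1

theorem frame_mulVec (Z : Mat n) (ξ : Fin n → ℂ) : frame Z *ᵥ ξ = Sum.elim (Z *ᵥ ξ) ξ := by
  rw [frame, Matrix.fromRows_mulVec, Matrix.one_mulVec]

theorem graph_eq_range (Z : U n) : graph Z = LinearMap.range (frame (Z : Mat n)).mulVecLin :=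
  SetLike.ext fun v => exists_congr fun ξ => by rw [Matrix.mulVecLin_apply, frame_mulVec]

theorem conjTranspose_fromRows_mul_phi_mul (A B C D : Mat n) :
    (Matrix.fromRows A B)ᴴ * phi n * Matrix.fromRows C D = Aᴴ * C - Bᴴ * D := by
  rw [Matrix.conjTranspose_fromRows_eq_fromCols_conjTranspose, phi,
    Matrix.fromCols_mul_fromBlocks, Matrix.fromCols_mul_fromRows]
  simp only [mul_one, mul_zero, add_zero, zero_add, mul_neg, neg_mul, sub_eq_add_neg]

theorem conjTranspose_frame_mul_phi_mul (Z v w : Mat n) :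
    (frame Z)ᴴ * phi n * Matrix.fromRows v w = Zᴴ * v - w := by
  rw [frame, conjTranspose_fromRows_mul_phi_mul, Matrix.conjTranspose_one, one_mul]

theorem conjTranspose_frame_mul_frame (Z : U n) :
    (frame (Z : Mat n))ᴴ * frame (Z : Mat n) = (2 : ℂ) • 1 := by
  rw [frame, Matrix.conjTranspose_fromRows_eq_fromCols_conjTranspose, Matrix.fromCols_mul_fromRows,
    U.star_mul, Matrix.conjTranspose_one, one_mul, two_smul]

theorem frame_mul_conjTranspose_frame (Z : U n) :
    frame (Z : Mat n) * (frame (Z : Mat n))ᴴ =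
      Matrix.fromBlocks 1 (Z : Mat n) (Z : Mat n)ᴴ 1 := by
  rw [frame, Matrix.conjTranspose_fromRows_eq_fromCols_conjTranspose, Matrix.fromRows_mul_fromCols,
    U.mul_star, Matrix.conjTranspose_one, mul_one, one_mul, mul_one]

theorem coe_J0 (x : Phase n) : (J0 x : Mat2 n) =
    -(frame (x.1 : Mat n) * (x.2 : Mat n) * (frame (x.1 : Mat n))ᴴ * phi n) := by
  rw [frame, Matrix.conjTranspose_fromRows_eq_fromCols_conjTranspose, Matrix.fromRows_mul,
    Matrix.fromRows_mul_fromCols, phi, Matrix.fromBlocks_multiply, Matrix.fromBlocks_neg]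
  simp [J0, ofBlocks, mem_iH.1 x.2.2]

theorem isLinearMap_fromRows : IsLinearMap ℝ fun p : Mat n × Mat n => Matrix.fromRows p.1 p.2 :=
  ⟨fun p q => by ext (i | i) j <;> rfl, fun r p => by ext (i | i) j <;> rfl⟩

theorem contDiff_frame : ContDiff ℝ ∞ (frame (n := n)) :=
  (contDiff_of_isLinearMap isLinearMap_fromRows).comp (contDiff_id.prodMk contDiff_const)

theorem hasDerivAt_frame {Z : ℝ → Mat n} {v : Mat n} {t : ℝ} (h : HasDerivAt Z v t) :
    HasDerivAt (fun s => frame (Z s)) (Matrix.fromRows v (0 : Mat n)) t :=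
  hasDerivAt_isLinearMap_comp isLinearMap_fromRows (h.prodMk (hasDerivAt_const t 1))

theorem contDiff_conjTranspose_frame : ContDiff ℝ ∞ fun Z : Mat n => (frame Z)ᴴ :=
  (contDiff_of_isLinearMap (L := Matrix.conjTranspose) isLinearMap_conjTranspose).comp
    contDiff_frame

theorem contDiff_frame_mul_mul_phi : ContDiff ℝ ∞ fun p : Mat n × Mat n =>
    -(frame p.1 * p.2 * (frame p.1)ᴴ * phi n) :=
  (contDiff_matrix_mul (contDiff_matrix_mul (contDiff_matrix_mul
    (contDiff_frame.comp contDiff_fst) contDiff_snd)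
    (contDiff_conjTranspose_frame.comp contDiff_fst)) contDiff_const).neg

theorem isSmooth_J0 (n : ℕ) : IsSmooth (J0 (n := n)) :=
  .of_contDiff contDiff_frame_mul_mul_phi coe_J0

end Frame

section IsotropicGrassmannian

variable {n : ℕ}

theorem projMat_eq_of_isHermitian {z : Submodule ℂ (Vec2 n)} {P : Mat2 n} (hP : P.IsHermitian)
    (hz : ∀ v, P *ᵥ v ∈ z) (hid : ∀ v ∈ z, P *ᵥ v = v) : projMat z = P := by
  rw [← LinearMap.toMatrix'_toLin' P]
  refine congrArg LinearMap.toMatrix' (LinearMap.ext fun v => ?_)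
  suffices h : (z.map (WithLp.linearEquiv 2 ℂ (Vec2 n)).symm.toLinearMap).starProjection
      (WithLp.toLp 2 v) = WithLp.toLp 2 (P *ᵥ v) from congrArg WithLp.ofLp h
  refine Submodule.eq_starProjection_of_mem_of_inner_eq_zero ⟨_, hz v, rfl⟩ ?_
  rintro _ ⟨u, hu, rfl⟩
  change inner ℂ (WithLp.toLp 2 (v - P *ᵥ v)) (WithLp.toLp 2 u) = 0
  rw [EuclideanSpace.inner_toLp_toLp, dotProduct_comm, star_sub, Matrix.star_mulVec, hP.eq,
    sub_dotProduct, ← Matrix.dotProduct_mulVec, hid u hu, sub_self]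

theorem projMat_graph (Z : U n) : projMat (graph Z) =
    (2⁻¹ : ℂ) • (frame (Z : Mat n) * (frame (Z : Mat n))ᴴ) := by
  refine projMat_eq_of_isHermitian ?_ (fun v => ?_) fun v hv => ?_
  · rw [Matrix.IsHermitian, Matrix.conjTranspose_smul, Matrix.conjTranspose_mul,
      Matrix.conjTranspose_conjTranspose, star_inv₀, star_ofNat]
  · rw [Matrix.smul_mulVec, ← Matrix.mulVec_mulVec, graph_eq_range]
    exact Submodule.smul_mem _ _ ⟨_, rfl⟩
  · rw [graph_eq_range] at hv
    obtain ⟨ξ, rfl⟩ := hv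
    rw [Matrix.mulVecLin_apply, Matrix.mulVec_mulVec, Matrix.smul_mul, Matrix.mul_assoc,
      conjTranspose_frame_mul_frame, Matrix.mul_smul, Matrix.mul_one, smul_smul,
      inv_mul_cancel₀ two_ne_zero, one_smul]

theorem two_smul_toBlocks₁₂_projMat_graph (Z : U n) :
    (2 : ℂ) • (projMat (graph Z)).toBlocks₁₂ = Z := by
  rw [projMat_graph, frame_mul_conjTranspose_frame, Matrix.fromBlocks_smul,
    Matrix.toBlocks_fromBlocks₁₂, smul_smul, mul_inv_cancel₀ two_ne_zero, one_smul]

theorem exists_range_mulVecLin_eq {ι 𝕜 : Type*} [Finite ι] [Field 𝕜]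
    {z : Submodule 𝕜 (ι → 𝕜)} {k : ℕ} (hz : Module.finrank 𝕜 z = k) : ∃ R : Matrix ι (Fin k) 𝕜,
      Function.Injective R.mulVec ∧ LinearMap.range R.mulVecLin = z := by
  let e : (Fin k → 𝕜) ≃ₗ[𝕜] z := LinearEquiv.ofFinrankEq _ _ (by rw [hz, Module.finrank_fin_fun])
  have hR : (LinearMap.toMatrix' (z.subtype ∘ₗ e.toLinearMap)).mulVecLin =
      z.subtype ∘ₗ e.toLinearMap := Matrix.toLin'_toMatrix' _
  refine ⟨LinearMap.toMatrix' (z.subtype ∘ₗ e.toLinearMap), ?_, ?_⟩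
  · change Function.Injective (Matrix.mulVecLin _)
    rw [hR]
    exact z.subtype_injective.comp e.injective
  · rw [hR, LinearMap.range_comp, LinearEquiv.range, Submodule.map_top, Submodule.range_subtype]

theorem mul_inv_mem_unitaryGroup {A B : Mat n} (h : Aᴴ * A = Bᴴ * B) (hB : IsUnit B) :
    A * B⁻¹ ∈ Matrix.unitaryGroup (Fin n) ℂ := by
  have hB' : B * B⁻¹ = 1 := Matrix.mul_nonsing_inv _ ((Matrix.isUnit_iff_isUnit_det _).1 hB)
  rw [Matrix.mem_unitaryGroup_iff', Matrix.star_eq_conjTranspose, Matrix.conjTranspose_mul]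
  calc (B⁻¹)ᴴ * Aᴴ * (A * B⁻¹) = (B⁻¹)ᴴ * (Aᴴ * A) * B⁻¹ := by simp only [mul_assoc]
    _ = (B * B⁻¹)ᴴ * (B * B⁻¹) := by rw [h, Matrix.conjTranspose_mul]; simp only [mul_assoc]
    _ = 1 := by rw [hB', Matrix.conjTranspose_one, one_mul]

open scoped ComplexOrder in
theorem conjTranspose_mul_phi_mul_self_eq_zero {R : Matrix (Fin n ⊕ Fin n) (Fin n) ℂ}
    (hR : LinearMap.range R.mulVecLin ≤ perp (LinearMap.range R.mulVecLin)) :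
    Rᴴ * phi n * R = 0 := by
  refine Matrix.ext_of_mulVec_single fun i => ?_
  rw [Matrix.zero_mulVec, ← dotProduct_self_star_eq_zero, dotProduct_comm]
  set η : Fin n → ℂ := Pi.single i 1
  set ξ := (Rᴴ * phi n * R) *ᵥ η with hξ
  have h : star (R *ᵥ ξ) ⬝ᵥ (phi n *ᵥ (R *ᵥ η)) = 0 := hR ⟨η, rfl⟩ _ ⟨ξ, rfl⟩
  rwa [Matrix.star_mulVec, ← Matrix.dotProduct_mulVec, Matrix.mulVec_mulVec, Matrix.mulVec_mulVec,
    ← hξ] at h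

open scoped ComplexOrder in
theorem isUnit_of_injective_fromRows {A B : Mat n} (h : Aᴴ * A = Bᴴ * B)
    (hAB : Function.Injective (Matrix.fromRows A B).mulVec) : IsUnit B := by
  rw [← Matrix.mulVec_injective_iff_isUnit]
  refine (injective_iff_map_eq_zero B.mulVecLin).2 fun ξ hξ => hAB ?_
  replace hξ : B *ᵥ ξ = 0 := hξ
  have hA : A *ᵥ ξ = 0 := by
    rw [← Matrix.conjTranspose_mul_self_mulVec_eq_zero, h, ← Matrix.mulVec_mulVec, hξ,
      Matrix.mulVec_zero]
  rw [Matrix.mulVec_zero, Matrix.fromRows_mulVec, hA, hξ]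
  exact Sum.elim_zero_zero

theorem frame_mul {A B : Mat n} (hB : IsUnit B) : frame (A * B⁻¹) * B = Matrix.fromRows A B := by
  rw [frame, Matrix.fromRows_mul, mul_assoc,
    Matrix.nonsing_inv_mul _ ((Matrix.isUnit_iff_isUnit_det _).1 hB), mul_one, one_mul]

theorem graph_eq_range_fromRows {Z : U n} {A B : Mat n} (hB : IsUnit B)
    (hZ : (Z : Mat n) = A * B⁻¹) :
    graph Z = LinearMap.range (Matrix.fromRows A B).mulVecLin := by
  have hsurj : LinearMap.range B.mulVecLin = ⊤ :=
    LinearMap.range_eq_top.2 (Matrix.mulVec_surjective_iff_isUnit.2 hB)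
  rw [graph_eq_range, hZ, ← frame_mul hB, Matrix.mulVecLin_mul, LinearMap.range_comp, hsurj,
    Submodule.map_top]

theorem I0base_surjective (n : ℕ) : Function.Surjective (I0base (n := n)) := by
  rintro ⟨⟨z, hz⟩, hp : perp z = z⟩
  obtain ⟨R, hR, rfl⟩ := exists_range_mulVecLin_eq hz
  obtain ⟨A, B, rfl⟩ : ∃ A B : Mat n, R = Matrix.fromRows A B :=
    ⟨_, _, (Matrix.fromRows_toRows R).symm⟩
  have hAB : Aᴴ * A = Bᴴ * B := by
    rw [← sub_eq_zero, ← conjTranspose_fromRows_mul_phi_mul]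
    exact conjTranspose_mul_phi_mul_self_eq_zero hp.ge
  have hB : IsUnit B := isUnit_of_injective_fromRows hAB hR
  exact ⟨⟨A * B⁻¹, mul_inv_mem_unitaryGroup hAB hB⟩,
    Subtype.ext (Subtype.ext (graph_eq_range_fromRows hB rfl))⟩

theorem isDiffeo_I0base (n : ℕ) : IsDiffeo (I0base (n := n)) := by
  refine IsDiffeo.of_surjective (g := fun Z : Mat n => (2⁻¹ : ℂ) • (frame Z * (frame Z)ᴴ))
    (g' := fun P : Mat2 n => (2 : ℂ) • P.toBlocks₁₂) ?_ ?_ projMat_graph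
    two_smul_toBlocks₁₂_projMat_graph (I0base_surjective n)
  · exact (contDiff_matrix_mul contDiff_frame contDiff_conjTranspose_frame).const_smul _
  · exact (contDiff_of_isLinearMap ⟨fun _ _ => rfl, fun _ _ => rfl⟩).const_smul _

end IsotropicGrassmannian

section IsotropicBundle

variable {n : ℕ}

theorem exists_ofBlocks_eq (X : unn n) :
    ∃ (α : iH n) (β : Mat n) (δ : iH n), ofBlocks α β δ = X := by
  obtain ⟨X, hX⟩ := X
  have h := mem_unn.1 hX
  rw [phi, ← Matrix.fromBlocks_toBlocks X, Matrix.fromBlocks_conjTranspose,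
    Matrix.fromBlocks_multiply, Matrix.fromBlocks_multiply, Matrix.fromBlocks_add,
    ← Matrix.fromBlocks_zero, Matrix.fromBlocks_inj] at h
  simp only [mul_one, mul_zero, add_zero, zero_add, mul_neg, neg_mul, one_mul, zero_mul,
    ← neg_add, neg_eq_zero] at h
  obtain ⟨hα, -, hβ, hδ⟩ := h
  refine ⟨⟨X.toBlocks₁₁, eq_neg_of_add_eq_zero_left hα⟩, X.toBlocks₁₂,
    ⟨X.toBlocks₂₂, eq_neg_of_add_eq_zero_left hδ⟩, Subtype.ext ?_⟩
  change Matrix.fromBlocks _ _ _ _ = X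
  rw [add_neg_eq_zero.1 hβ, Matrix.fromBlocks_toBlocks]

theorem J0_eq_ofBlocks {Z : U n} {α δ : iH n} {β : Mat n}
    (h : (ofBlocks α β δ : Mat2 n) * frame (Z : Mat n) = 0) : J0 (Z, δ) = ofBlocks α β δ := by
  rw [ofBlocks, frame, Matrix.fromBlocks_mul_fromRows, mul_one, mul_one,
    ← Matrix.fromRows_zero, Matrix.fromRows_inj.eq_iff] at h
  have hβ : β = -((α : Mat n) * (Z : Mat n)) := eq_neg_of_add_eq_zero_right h.1
  have hδ : (Z : Mat n) * (δ : Mat n) = β := by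
    rw [eq_neg_of_add_eq_zero_right h.2, hβ, Matrix.conjTranspose_neg, Matrix.conjTranspose_mul,
      mem_iH.1 α.2]
    simp only [mul_neg, neg_neg, ← mul_assoc, U.mul_star, one_mul]
  refine congrArg₂ (ofBlocks · · δ) (Subtype.ext ?_) hδ
  change -((Z : Mat n) * (δ : Mat n) * (Z : Mat n)ᴴ) = α
  rw [hδ, hβ, neg_mul, neg_neg, mul_assoc, U.mul_star, mul_one]

theorem exists_J0_eq (Z : U n) {X : Mat2 n} (hX : X ∈ unn n)
    (hXZ : graph Z ≤ LinearMap.ker X.mulVecLin) : ∃ ρ : iH n, (J0 (Z, ρ) : Mat2 n) = X := by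
  have hXQ : X * frame (Z : Mat n) = 0 := Matrix.ext_of_mulVec_single fun i => by
    rw [← Matrix.mulVec_mulVec, Matrix.zero_mulVec]
    exact hXZ (graph_eq_range Z ▸ ⟨_, rfl⟩)
  obtain ⟨α, β, δ, hblocks⟩ := exists_ofBlocks_eq ⟨X, hX⟩
  obtain rfl := congrArg Subtype.val hblocks
  exact ⟨δ, congrArg Subtype.val (J0_eq_ofBlocks hXQ)⟩

theorem exists_I0_eq (Z : U n) (p : N0 n) (hp : p.proj = I0base Z) : ∃ ρ, I0 (Z, ρ) = p := by
  obtain ⟨⟨X, z⟩, ⟨hz, hzX⟩, hX, hz'⟩ := p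
  obtain rfl : z = ⟨graph Z, finrank_graph Z⟩ := congrArg Subtype.val hp
  obtain ⟨ρ, hρ⟩ := exists_J0_eq Z (mem_unn_of_inv_eq hX) hzX
  exact ⟨ρ, Subtype.ext (Prod.ext hρ rfl)⟩

theorem isDiffeo_I0 (n : ℕ) : IsDiffeo (I0 (n := n)) := by
  refine IsDiffeo.of_surjective
    (g := fun p : Mat n × Mat n => (-(frame p.1 * p.2 * (frame p.1)ᴴ * phi n),
      (2⁻¹ : ℂ) • (frame p.1 * (frame p.1)ᴴ)))
    (g' := fun P : Mat2 n × Mat2 n => ((2 : ℂ) • P.2.toBlocks₁₂, P.1.toBlocks₂₂)) ?_ ?_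
    (fun x => Prod.ext (coe_J0 x) (projMat_graph x.1))
    (fun x => Prod.ext (two_smul_toBlocks₁₂_projMat_graph x.1) rfl) fun p => ?_
  · exact contDiff_frame_mul_mul_phi.prodMk <| ((contDiff_matrix_mul contDiff_frame
      contDiff_conjTranspose_frame).comp contDiff_fst).const_smul _
  · exact contDiff_of_isLinearMap ⟨fun P P' => Prod.ext (smul_add _ _ _) rfl,
      fun r P => Prod.ext (smul_comm (2 : ℂ) r P.2.toBlocks₁₂) rfl⟩
  · obtain ⟨Z, hZ⟩ := I0base_surjective n p.proj
    obtain ⟨ρ, hρ⟩ := exists_I0_eq Z p hZ.symm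
    exact ⟨(Z, ρ), hρ⟩

theorem I0_injective (n : ℕ) : Function.Injective (I0 (n := n)) :=
  (isDiffeo_I0 n).choose_spec.1.injective

/-- The linear map to which `I0` restricts on the fibre over `Z`. -/
def I0Fibre (Z : U n) : iH n →ₗ[ℝ] N0.fibre (I0base Z) where
  toFun ρ := ⟨J0 (Z, ρ), (I0 (Z, ρ)).2.1, (I0 (Z, ρ)).2.2.1⟩
  map_add' ρ σ := Subtype.ext <| by
    simp only [Submodule.coe_add, coe_J0, Matrix.mul_add, Matrix.add_mul, neg_add]
  map_smul' r ρ := Subtype.ext <| by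
    simp only [Submodule.coe_smul, coe_J0, Matrix.mul_smul, Matrix.smul_mul, RingHom.id_apply,
      smul_neg]

theorem I0Fibre_bijective (Z : U n) : Function.Bijective (I0Fibre Z) := by
  refine ⟨fun ρ σ h => Subtype.ext (congrArg (fun X => (X : Mat2 n).toBlocks₂₂)
    (congrArg Subtype.val h)), fun X => ?_⟩
  obtain ⟨ρ, hρ⟩ := exists_J0_eq Z (mem_unn_of_inv_eq X.2.2) X.2.1.2
  exact ⟨ρ, Subtype.ext hρ⟩

end IsotropicBundle

section Action

variable {n : ℕ}

theorem mat_mul_frame_eq_fromRows (g : Unn n) (Z : U n) :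
    g.mat * frame (Z : Mat n) = Matrix.fromRows (numer g Z) (denom g Z) := by
  rw [frame, ← Matrix.fromBlocks_toBlocks g.mat, Matrix.fromBlocks_mul_fromRows, mul_one, mul_one]
  rfl

theorem mat_mul_frame (g : Unn n) (x : Phase n) :
    g.mat * frame (x.1 : Mat n) = frame ((Lam g x).1 : Mat n) * denom g x.1 := by
  rw [mat_mul_frame_eq_fromRows]
  exact (frame_mul (denom_isUnit g x.1)).symm

theorem conjTranspose_mat_mul_phi (g : Unn n) : g.matᴴ * phi n = phi n * (g⁻¹).mat := by
  rw [g.inv_mat, ← mul_assoc, ← mul_assoc, phi_mul_phi, one_mul]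

theorem J0_equivariant (g : Unn n) (x : Phase n) :
    g.mat * (J0 x : Mat2 n) * (g⁻¹).mat = J0 (Lam g x) := by
  have hρ : ((Lam g x).2 : Mat n) = denom g x.1 * (x.2 : Mat n) * (denom g x.1)ᴴ := rfl
  rw [coe_J0, coe_J0, hρ, mul_neg, neg_mul, eq_comm]
  refine congrArg Neg.neg ?_
  calc frame ((Lam g x).1 : Mat n) * (denom g x.1 * (x.2 : Mat n) * (denom g x.1)ᴴ) *
        (frame ((Lam g x).1 : Mat n))ᴴ * phi n
      = frame ((Lam g x).1 : Mat n) * denom g x.1 * (x.2 : Mat n) *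
        (frame ((Lam g x).1 : Mat n) * denom g x.1)ᴴ * phi n := by
        simp only [Matrix.conjTranspose_mul, Matrix.mul_assoc]
    _ = g.mat * (frame (x.1 : Mat n) * (x.2 : Mat n) * (frame (x.1 : Mat n))ᴴ) *
        (g.matᴴ * phi n) := by
        rw [← mat_mul_frame]
        simp only [Matrix.conjTranspose_mul, Matrix.mul_assoc]
    _ = _ := by
        rw [conjTranspose_mat_mul_phi]
        simp only [Matrix.mul_assoc]

theorem map_graph (g : Unn n) (x : Phase n) :
    (graph x.1).map g.equiv.toLinearMap = graph (Lam g x).1 := by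
  rw [graph_eq_range_fromRows (denom_isUnit g x.1) (rfl : ((Lam g x).1 : Mat n) = _),
    ← mat_mul_frame_eq_fromRows, Matrix.mulVecLin_mul, LinearMap.range_comp, graph_eq_range]
  rfl

theorem I0_Lam (g : Unn n) (x : Phase n) : I0 (Lam g x) = Sig g (I0 x) :=
  Subtype.ext (Prod.ext (J0_equivariant g x).symm (Subtype.ext (map_graph g x).symm))

theorem Sig_one (p : N0 n) : Sig 1 p = p := by
  have h₁ : (1 : Unn n).mat = 1 := rfl
  have hequiv : (1 : Unn n).equiv.toLinearMap = LinearMap.id := Matrix.mulVecLin_one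
  refine Subtype.ext (Prod.ext ?_ (Subtype.ext ?_))
  · change (1 : Unn n).mat * p.1.1 * (1⁻¹ : Unn n).mat = p.1.1
    rw [inv_one, h₁, one_mul, mul_one]
  · change p.1.2.1.map _ = p.1.2.1
    rw [hequiv, Submodule.map_id]

theorem Sig_mul (g h : Unn n) (p : N0 n) : Sig (g * h) p = Sig g (Sig h p) := by
  have hmul (a b : Unn n) : (a * b).mat = a.mat * b.mat := rfl
  have hequiv : (g * h).equiv.toLinearMap = g.equiv.toLinearMap ∘ₗ h.equiv.toLinearMap :=
    Matrix.mulVecLin_mul _ _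
  refine Subtype.ext (Prod.ext ?_ (Subtype.ext ?_))
  · change (g * h).mat * p.1.1 * ((g * h)⁻¹).mat = g.mat * (h.mat * p.1.1 * (h⁻¹).mat) * (g⁻¹).mat
    rw [mul_inv_rev, hmul, hmul]
    simp only [mul_assoc]
  · change p.1.2.1.map _ = (p.1.2.1.map _).map _
    rw [hequiv, Submodule.map_comp]

theorem Lam_one (x : Phase n) : Lam 1 x = x := I0_injective n (by rw [I0_Lam, Sig_one])

theorem Lam_mul (g h : Unn n) (x : Phase n) : Lam (g * h) x = Lam g (Lam h x) :=
  I0_injective n (by rw [I0_Lam, I0_Lam, I0_Lam, Sig_mul])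

/-- The formula for `(g, Z, ρ) ↦ Λ_g(Z, ρ)` on arbitrary matrices. It is smooth where `CZ + D` is
invertible; elsewhere the inverse is `0`. -/
noncomputable def lamExtension (q : Mat2 n × Mat n × Mat n) : Mat n × Mat n :=
  ((q.1.toBlocks₁₁ * q.2.1 + q.1.toBlocks₁₂) * (q.1.toBlocks₂₁ * q.2.1 + q.1.toBlocks₂₂)⁻¹,
    (q.1.toBlocks₂₁ * q.2.1 + q.1.toBlocks₂₂) * q.2.2 *
      (q.1.toBlocks₂₁ * q.2.1 + q.1.toBlocks₂₂)ᴴ)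

theorem contDiffAt_lamExtension {q : Mat2 n × Mat n × Mat n}
    (hq : IsUnit (q.1.toBlocks₂₁ * q.2.1 + q.1.toBlocks₂₂)) : ContDiffAt ℝ ∞ lamExtension q := by
  have hblock {L : Mat2 n → Mat n} (hL : IsLinearMap ℝ L) :
      ContDiff ℝ ∞ fun q : Mat2 n × Mat n × Mat n => L q.1 :=
    (contDiff_of_isLinearMap hL).comp contDiff_fst
  have hZ : ContDiff ℝ ∞ fun q : Mat2 n × Mat n × Mat n => q.2.1 :=
    contDiff_fst.comp contDiff_snd
  have hnum : ContDiff ℝ ∞ fun q : Mat2 n × Mat n × Mat n =>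
      q.1.toBlocks₁₁ * q.2.1 + q.1.toBlocks₁₂ :=
    ((hblock ⟨fun _ _ => rfl, fun _ _ => rfl⟩).mul hZ).add
      (hblock ⟨fun _ _ => rfl, fun _ _ => rfl⟩)
  have hden : ContDiff ℝ ∞ fun q : Mat2 n × Mat n × Mat n =>
      q.1.toBlocks₂₁ * q.2.1 + q.1.toBlocks₂₂ :=
    ((hblock ⟨fun _ _ => rfl, fun _ _ => rfl⟩).mul hZ).add
      (hblock ⟨fun _ _ => rfl, fun _ _ => rfl⟩)
  have hconj : ContDiff ℝ ∞ (Matrix.conjTranspose : Mat n → Mat n) :=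
    contDiff_of_isLinearMap isLinearMap_conjTranspose
  exact (hnum.contDiffAt.mul ((contDiffAt_matrix_inv hq).comp q hden.contDiffAt)).prodMk
    ((hden.mul (contDiff_snd.comp contDiff_snd)).mul (hconj.comp hden)).contDiffAt

theorem contDiff_emb_Lam {E : Type*} [NormedAddCommGroup E] [NormedSpace ℝ E] {G : E → Unn n}
    {x : E → Phase n} (hG : ContDiff ℝ ∞ fun p => (G p).mat)
    (hx : ContDiff ℝ ∞ fun p => emb (x p)) : ContDiff ℝ ∞ fun p => emb (Lam (G p) (x p)) := by
  refine contDiff_iff_contDiffAt.2 fun p => ?_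
  exact ContDiffAt.comp (g := lamExtension) (f := fun p => ((G p).mat, emb (x p))) p
    (contDiffAt_lamExtension (denom_isUnit (G p) (x p).1)) (hG.prodMk hx).contDiffAt

theorem isSmooth_Lam (g : Unn n) : IsSmooth (Lam g) := by
  have hden : Continuous fun p : Mat n × Mat n =>
      g.mat.toBlocks₂₁ * p.1 + g.mat.toBlocks₂₂ :=
    (continuous_const.mul continuous_fst).add continuous_const
  refine IsSmooth.of_contDiffOn (g := fun p => lamExtension (g.mat, p))
    (Units.isOpen.preimage hden) (fun p hp => ?_) (fun x => denom_isUnit g x.1) fun x => rfl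
  exact ((contDiffAt_lamExtension (q := (g.mat, p)) hp).comp p
    (contDiff_const.prodMk contDiff_id).contDiffAt).contDiffWithinAt

theorem isSmooth_Sig (g : Unn n) : IsSmooth (Sig g) := by
  obtain ⟨k, -, hk, hI, hks⟩ := isDiffeo_I0 n
  have h : Sig g = I0 ∘ Lam g ∘ k := funext fun p => by
    rw [Function.comp_apply, Function.comp_apply, I0_Lam, hk]
  rw [h]
  exact hI.comp ((isSmooth_Lam g).comp hks)

end Action

section ExteriorDerivative

variable {n : ℕ}

theorem hasDerivAt_gamma0 (c : SmoothCurve (Phase n)) {V : ∀ t, Tan (c.toFun t)}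
    {m : Mat n × Mat n} {t : ℝ} (hV : HasDerivAt (fun s => (V s : Mat n × Mat n)) m t) :
    HasDerivAt (fun s => gamma0 (c.toFun s) (V s))
      ((((c.vel t : Mat n × Mat n).2 * ((c.toFun t).1 : Mat n)ᴴ +
          ((c.toFun t).2 : Mat n) * (c.vel t : Mat n × Mat n).1ᴴ) * (V t : Mat n × Mat n).1 +
        ((c.toFun t).2 : Mat n) * ((c.toFun t).1 : Mat n)ᴴ * m.1).trace.re) t := by
  have hZ := hasDerivAt_isLinearMap_comp isLinearMap_conjTranspose (hasDerivAt_base c t)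
  have hv : HasDerivAt (fun s => (V s : Mat n × Mat n).1) m.1 t :=
    (ContinuousLinearMap.fst ℝ (Mat n) (Mat n)).hasFDerivAt.comp_hasDerivAt t hV
  exact hasDerivAt_isLinearMap_comp isLinearMap_re_trace (((c.hasDerivAt_snd t).mul hZ).mul hv)

/-- The symplectic form `dγ₀`; as `Z⁺Z = 1` forces `dZ⁺ = -Z⁺ dZ Z⁺`, it is the real part of
`Tr(dρ ∧ Z⁺dZ + ρ dZ⁺ ∧ dZ)`. -/
noncomputable def omega (x : Phase n) : Tan x →ₗ[ℝ] Tan x →ₗ[ℝ] ℝ :=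
  LinearMap.mk₂ ℝ
    (fun V W => ((V : Mat n × Mat n).2 * (x.1 : Mat n)ᴴ * (W : Mat n × Mat n).1 -
      (W : Mat n × Mat n).2 * (x.1 : Mat n)ᴴ * (V : Mat n × Mat n).1 +
      (x.2 : Mat n) * ((V : Mat n × Mat n).1ᴴ * (W : Mat n × Mat n).1 -
        (W : Mat n × Mat n).1ᴴ * (V : Mat n × Mat n).1)).trace.re)
    (fun V V' W => by
      rw [← Complex.add_re, ← Matrix.trace_add]
      simp only [Submodule.coe_add, Prod.fst_add, Prod.snd_add, Matrix.conjTranspose_add]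
      congr 2; noncomm_ring)
    (fun r V W => by
      simp only [Submodule.coe_smul, Prod.smul_fst, Prod.smul_snd, Matrix.conjTranspose_smul,
        star_trivial, smul_mul_assoc, mul_smul_comm, ← smul_sub, ← smul_add, Matrix.trace_smul,
        Complex.smul_re])
    (fun V W W' => by
      rw [← Complex.add_re, ← Matrix.trace_add]
      simp only [Submodule.coe_add, Prod.fst_add, Prod.snd_add, Matrix.conjTranspose_add]
      congr 2; noncomm_ring)
    (fun r V W => by
      simp only [Submodule.coe_smul, Prod.smul_fst, Prod.smul_snd, Matrix.conjTranspose_smul,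
        star_trivial, smul_mul_assoc, mul_smul_comm, ← smul_sub, ← smul_add, Matrix.trace_smul,
        Complex.smul_re])

theorem omega_apply (x : Phase n) (V W : Tan x) : omega x V W =
    ((V : Mat n × Mat n).2 * (x.1 : Mat n)ᴴ * (W : Mat n × Mat n).1 -
      (W : Mat n × Mat n).2 * (x.1 : Mat n)ᴴ * (V : Mat n × Mat n).1 +
      (x.2 : Mat n) * ((V : Mat n × Mat n).1ᴴ * (W : Mat n × Mat n).1 -
        (W : Mat n × Mat n).1ᴴ * (V : Mat n × Mat n).1)).trace.re := rfl

theorem isExteriorDerivative_omega (n : ℕ) : IsExteriorDerivative gamma0 (omega (n := n)) := by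
  intro σ
  obtain ⟨m, hm₂, hm₁⟩ := σ.exists_mixed_partial
  refine ⟨_, _, hasDerivAt_gamma0 (σ.curve₁ 0) (V := fun s => σ.vel₂ s 0) hm₂,
    hasDerivAt_gamma0 (σ.curve₂ 0) (V := fun t => σ.vel₁ 0 t) hm₁, ?_⟩
  rw [omega_apply, ← Complex.sub_re, ← Matrix.trace_sub]
  refine congrArg (fun a : Mat n => a.trace.re) ?_
  set Z : Mat n := ((σ.toFun 0 0).1 : Mat n)
  set ρ : Mat n := ((σ.toFun 0 0).2 : Mat n)
  set v₁ : Mat n × Mat n := (σ.vel₁ 0 0 : Mat n × Mat n)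
  set v₂ : Mat n × Mat n := (σ.vel₂ 0 0 : Mat n × Mat n)
  change v₁.2 * Zᴴ * v₂.1 - v₂.2 * Zᴴ * v₁.1 + ρ * (v₁.1ᴴ * v₂.1 - v₂.1ᴴ * v₁.1) =
    (v₁.2 * Zᴴ + ρ * v₁.1ᴴ) * v₂.1 + ρ * Zᴴ * m.1 - ((v₂.2 * Zᴴ + ρ * v₂.1ᴴ) * v₁.1 + ρ * Zᴴ * m.1)
  noncomm_ring

theorem omega_isAlt (x : Phase n) : (omega x).IsAlt := fun V => by
  rw [omega_apply, sub_self, sub_self, mul_zero, add_zero, Matrix.trace_zero, Complex.zero_re]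

theorem exists_tan_eq {x : Phase n} (V : Tan x) :
    ∃ a r : iH n, (V : Mat n × Mat n) = ((x.1 : Mat n) * a, (r : Mat n)) := by
  obtain ⟨ha, hr⟩ := mem_tan_phase.1 V.2
  refine ⟨⟨_, ha⟩, ⟨_, hr⟩, Prod.ext ?_ rfl⟩
  rw [← mul_assoc, U.mul_star, one_mul]

theorem mk_mem_tan (x : Phase n) (a r : iH n) : ((x.1 : Mat n) * a, (r : Mat n)) ∈ Tan x := by
  rw [mem_tan_phase, ← mul_assoc, U.star_mul, one_mul]
  exact ⟨a.2, r.2⟩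

theorem omega_apply_of_eq {x : Phase n} {V W : Tan x} {a b r s : iH n}
    (hV : (V : Mat n × Mat n) = ((x.1 : Mat n) * a, (r : Mat n)))
    (hW : (W : Mat n × Mat n) = ((x.1 : Mat n) * b, (s : Mat n))) :
    omega x V W = ((r : Mat n) * b - s * a - (x.2 : Mat n) * (a * b - b * a)).trace.re := by
  have hZ (c : Mat n) : (x.1 : Mat n)ᴴ * ((x.1 : Mat n) * c) = c := by
    rw [← mul_assoc, U.star_mul, one_mul]
  simp only [omega_apply, hV, hW, Matrix.conjTranspose_mul, mem_iH.1 a.2, mem_iH.1 b.2, mul_assoc,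
    hZ, neg_mul]
  congr 2
  noncomm_ring

theorem omega_nondegenerate (x : Phase n) : (omega x).Nondegenerate := by
  have hleft : ∀ V, (∀ W, omega x V W = 0) → V = 0 := by
    intro V h
    obtain ⟨a, r, hV⟩ := exists_tan_eq V
    have ha : (a : Mat n) = 0 := by
      refine eq_zero_of_re_trace_mul_self a.2 ?_
      simpa using (omega_apply_of_eq hV rfl).symm.trans (h ⟨_, mk_mem_tan x 0 a⟩)
    have hr : (r : Mat n) = 0 := by
      refine eq_zero_of_re_trace_mul_self r.2 ?_
      simpa [ha] using (omega_apply_of_eq hV rfl).symm.trans (h ⟨_, mk_mem_tan x r 0⟩)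
    exact Subtype.ext (by rw [hV, ha, hr, mul_zero]; rfl)
  exact ⟨hleft, fun V h => hleft V fun W => by rw [← (omega_isAlt x).neg, h, neg_zero]⟩

theorem exp_mem_unitaryGroup (a : iH n) :
    NormedSpace.exp (a : Mat n) ∈ Matrix.unitaryGroup (Fin n) ℂ := by
  rw [Matrix.mem_unitaryGroup_iff', Matrix.star_eq_conjTranspose, ← Matrix.exp_conjTranspose,
    mem_iH.1 a.2, ← Matrix.exp_add_of_commute _ _ (Commute.refl (a : Mat n)).neg_left,
    neg_add_cancel, NormedSpace.exp_zero]

/-- The surface `(p, q) ↦ (Z exp(pa + qb), ρ + pr + qs)` through `x = (Z, ρ)`; its partial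
velocities there are `(Za, r)` and `(Zb, s)`. -/
noncomputable def expSurface (x : Phase n) (a b r s : iH n) : SmoothSurface (Phase n) where
  toFun p q := (x.1 * ⟨_, exp_mem_unitaryGroup (p • a + q • b)⟩, x.2 + p • r + q • s)
  smooth := by
    change ContDiff ℝ ∞ (fun p : ℝ × ℝ =>
      ((x.1 : Mat n) * NormedSpace.exp (p.1 • (a : Mat n) + p.2 • (b : Mat n)),
        (x.2 : Mat n) + p.1 • (r : Mat n) + p.2 • (s : Mat n)))
    refine ContDiff.prodMk (contDiff_const.mul (contDiff_matrix_exp.comp ?_)) ?_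
    · exact (contDiff_fst.smul contDiff_const).add (contDiff_snd.smul contDiff_const)
    · exact (contDiff_const.add (contDiff_fst.smul contDiff_const)).add
        (contDiff_snd.smul contDiff_const)

theorem emb_expSurface (x : Phase n) (a b r s : iH n) (p q : ℝ) :
    emb ((expSurface x a b r s).toFun p q) =
      ((x.1 : Mat n) * NormedSpace.exp (p • (a : Mat n) + q • (b : Mat n)),
        (x.2 : Mat n) + p • (r : Mat n) + q • (s : Mat n)) := rfl

theorem expSurface_zero (x : Phase n) (a b r s : iH n) :
    (expSurface x a b r s).toFun 0 0 = x :=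
  emb_injective (by simp [emb_expSurface]; rfl)

theorem hasDerivAt_exp_line (x : Phase n) (a r : iH n) :
    HasDerivAt (fun p : ℝ => ((x.1 : Mat n) * NormedSpace.exp (p • (a : Mat n)),
      (x.2 : Mat n) + p • (r : Mat n))) ((x.1 : Mat n) * a, (r : Mat n)) 0 :=
  ((hasDerivAt_matrix_exp_smul (a : Mat n)).const_mul (x.1 : Mat n)).prodMk <|
    (((hasDerivAt_id (0 : ℝ)).smul_const (r : Mat n)).const_add (x.2 : Mat n)).congr_deriv
      (one_smul _ _)

theorem expSurface_vel₁ (x : Phase n) (a b r s : iH n) :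
    ((expSurface x a b r s).vel₁ 0 0 : Mat n × Mat n) = ((x.1 : Mat n) * a, (r : Mat n)) := by
  have h := (expSurface x a b r s).hasDerivAt_vel₁ 0 0
  simp only [emb_expSurface, zero_smul, add_zero] at h
  exact h.unique (hasDerivAt_exp_line x a r)

theorem expSurface_vel₂ (x : Phase n) (a b r s : iH n) :
    ((expSurface x a b r s).vel₂ 0 0 : Mat n × Mat n) = ((x.1 : Mat n) * b, (s : Mat n)) := by
  have h := (expSurface x a b r s).hasDerivAt_vel₂ 0 0
  simp only [emb_expSurface, zero_smul, add_zero, zero_add] at h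
  exact h.unique (hasDerivAt_exp_line x b s)

theorem IsExteriorDerivative.eq_omega {Ω : ∀ x : Phase n, Tan x →ₗ[ℝ] Tan x →ₗ[ℝ] ℝ}
    (hΩ : IsExteriorDerivative gamma0 Ω) : Ω = omega := by
  refine hΩ.unique (isExteriorDerivative_omega n) fun x V W => ?_
  obtain ⟨a, r, hV⟩ := exists_tan_eq V
  obtain ⟨b, s, hW⟩ := exists_tan_eq W
  exact ⟨expSurface x a b r s, expSurface_zero .., by rw [expSurface_vel₁, hV],
    by rw [expSurface_vel₂, hW]⟩

end ExteriorDerivative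

section MovingAction

variable {n : ℕ}

theorem conjTranspose_frame_mul_phi_mul_frame (Z : U n) :
    (frame (Z : Mat n))ᴴ * phi n * frame (Z : Mat n) = 0 := by
  nth_rw 2 [frame]
  rw [conjTranspose_frame_mul_phi_mul, U.star_mul, sub_self]

theorem conjTranspose_mul_vel_mul {g : Unn n} {Z Z₁ : U n} {D D' v v₁ : Mat n} {G' : Mat2 n}
    (h : g.mat * frame (Z : Mat n) = frame (Z₁ : Mat n) * D)
    (h' : G' * frame (Z : Mat n) + g.mat * Matrix.fromRows v (0 : Mat n) =
      Matrix.fromRows v₁ (0 : Mat n) * D + frame (Z₁ : Mat n) * D') :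
    Dᴴ * ((Z₁ : Mat n)ᴴ * v₁) * D =
      (frame (Z : Mat n))ᴴ * phi n * (g⁻¹.mat * G') * frame (Z : Mat n) + (Z : Mat n)ᴴ * v := by
  have hv (Z v : Mat n) : (frame Z)ᴴ * phi n * Matrix.fromRows v (0 : Mat n) = Zᴴ * v := by
    rw [conjTranspose_frame_mul_phi_mul, sub_zero]
  calc Dᴴ * ((Z₁ : Mat n)ᴴ * v₁) * D
      = Dᴴ * ((frame (Z₁ : Mat n))ᴴ * phi n * Matrix.fromRows v₁ (0 : Mat n)) * D +
        Dᴴ * ((frame (Z₁ : Mat n))ᴴ * phi n * frame (Z₁ : Mat n)) * D' := by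
        rw [hv, conjTranspose_frame_mul_phi_mul_frame, mul_zero, zero_mul, add_zero]
    _ = (frame (Z₁ : Mat n) * D)ᴴ * phi n *
        (Matrix.fromRows v₁ (0 : Mat n) * D + frame (Z₁ : Mat n) * D') := by
        simp only [Matrix.conjTranspose_mul, Matrix.mul_add, Matrix.mul_assoc]
    _ = (frame (Z : Mat n))ᴴ * (g.matᴴ * phi n) *
        (G' * frame (Z : Mat n) + g.mat * Matrix.fromRows v (0 : Mat n)) := by
        rw [← h', ← h]
        simp only [Matrix.conjTranspose_mul, Matrix.mul_assoc]
    _ = (frame (Z : Mat n))ᴴ * phi n * (g⁻¹.mat * G') * frame (Z : Mat n) +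
        (frame (Z : Mat n))ᴴ * phi n * (g⁻¹.mat * g.mat) * Matrix.fromRows v (0 : Mat n) := by
        rw [conjTranspose_mat_mul_phi]
        simp only [Matrix.mul_add, Matrix.mul_assoc]
    _ = _ := by rw [g.inv_mul_mat, Matrix.mul_one, hv]

theorem hasDerivAt_denom {G : ℝ → Unn n} {G' : Mat2 n} {t : ℝ}
    (hG : HasDerivAt (fun s => (G s).mat) G' t) (c : SmoothCurve (Phase n)) :
    ∃ D', HasDerivAt (fun s => denom (G s) (c.toFun s).1) D' t := by
  have h := hasDerivAt_matrix_mul hG (hasDerivAt_frame (hasDerivAt_base c t))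
  refine ⟨_, (hasDerivAt_isLinearMap_comp (L := Matrix.toRows₂) ⟨fun _ _ => rfl, fun _ _ => rfl⟩
    h).congr_of_eventuallyEq (.of_forall fun s => ?_)⟩
  simp only [mat_mul_frame_eq_fromRows, Matrix.toRows₂_fromRows]

theorem conjTranspose_denom_mul_vel_mul_denom {G : ℝ → Unn n} {G' : Mat2 n} {t : ℝ}
    (hG : HasDerivAt (fun s => (G s).mat) G' t) {c c' : SmoothCurve (Phase n)}
    (hc : ∀ s, c'.toFun s = Lam (G s) (c.toFun s)) :
    (denom (G t) (c.toFun t).1)ᴴ * (((c'.toFun t).1 : Mat n)ᴴ * (c'.vel t : Mat n × Mat n).1) *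
        denom (G t) (c.toFun t).1 =
      (frame ((c.toFun t).1 : Mat n))ᴴ * phi n * ((G t)⁻¹.mat * G') *
          frame ((c.toFun t).1 : Mat n) +
        ((c.toFun t).1 : Mat n)ᴴ * (c.vel t : Mat n × Mat n).1 := by
  have h (s : ℝ) : (G s).mat * frame ((c.toFun s).1 : Mat n) =
      frame ((c'.toFun s).1 : Mat n) * denom (G s) (c.toFun s).1 := by
    rw [hc, mat_mul_frame]
  obtain ⟨D', hD⟩ := hasDerivAt_denom hG c
  exact conjTranspose_mul_vel_mul (h t) <|
    (hasDerivAt_matrix_mul hG (hasDerivAt_frame (hasDerivAt_base c t))).unique <|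
      (hasDerivAt_matrix_mul (hasDerivAt_frame (hasDerivAt_base c' t)) hD).congr_of_eventuallyEq
        (.of_forall h)

theorem gamma0_vel_Lam {G : ℝ → Unn n} {G' : Mat2 n}
    (hG : HasDerivAt (fun s => (G s).mat) G' 0) {c c' : SmoothCurve (Phase n)}
    (hc : ∀ s, c'.toFun s = Lam (G s) (c.toFun s)) :
    gamma0 (c'.toFun 0) (c'.vel 0) = gamma0 (c.toFun 0) (c.vel 0) -
      ((J0 (c.toFun 0) : Mat2 n) * ((G 0)⁻¹.mat * G')).trace.re := by
  set Z : Mat n := ((c.toFun 0).1 : Mat n)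
  set ρ : Mat n := ((c.toFun 0).2 : Mat n)
  set D : Mat n := denom (G 0) (c.toFun 0).1
  set X : Mat2 n := (G 0)⁻¹.mat * G'
  have hρ : ((c'.toFun 0).2 : Mat n) = D * ρ * Dᴴ := by rw [hc]; rfl
  rw [eq_sub_iff_add_eq, gamma0_apply, gamma0_apply, ← Complex.add_re, coe_J0, hρ]
  congr 1
  calc (D * ρ * Dᴴ * ((c'.toFun 0).1 : Mat n)ᴴ * (c'.vel 0 : Mat n × Mat n).1).trace +
        (-(frame Z * ρ * (frame Z)ᴴ * phi n) * X).trace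
      = (ρ * (Dᴴ * (((c'.toFun 0).1 : Mat n)ᴴ * (c'.vel 0 : Mat n × Mat n).1) * D)).trace -
        (ρ * ((frame Z)ᴴ * phi n * X * frame Z)).trace := by
        simp only [neg_mul, Matrix.trace_neg, ← sub_eq_add_neg, Matrix.mul_assoc]
        rw [Matrix.trace_mul_comm D, Matrix.trace_mul_comm (frame Z)]
        simp only [Matrix.mul_assoc]
    _ = _ := by
        rw [conjTranspose_denom_mul_vel_mul_denom hG hc, mul_add, Matrix.trace_add,
          add_sub_cancel_left, mul_assoc]

end MovingAction

section Momentum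

variable {n : ℕ}

theorem gamma0_vel_Lam_const (g : Unn n) {c c' : SmoothCurve (Phase n)}
    (hc : ∀ t, c'.toFun t = Lam g (c.toFun t)) :
    gamma0 (c'.toFun 0) (c'.vel 0) = gamma0 (c.toFun 0) (c.vel 0) := by
  simpa using gamma0_vel_Lam (hasDerivAt_const 0 g.mat) hc

theorem gamma0_invariant (g : Unn n) (c : SmoothCurve (Phase n)) :
    ∃ c' : SmoothCurve (Phase n), (∀ t, c'.toFun t = Lam g (c.toFun t)) ∧
      gamma0 (c'.toFun 0) (c'.vel 0) = gamma0 (c.toFun 0) (c.vel 0) :=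
  ⟨c.map (isSmooth_Lam g), fun _ => rfl, gamma0_vel_Lam_const g fun _ => rfl⟩

theorem expUnn_zero : expUnn (0 : unn n) = 1 :=
  Subtype.ext (Units.ext NormedSpace.exp_zero)

theorem contDiff_expUnn_smul_mat (ξ : unn n) : ContDiff ℝ ∞ fun t : ℝ => (expUnn (t • ξ)).mat :=
  contDiff_matrix_exp.comp (contDiff_id.smul contDiff_const)

/-- The orbit `t ↦ Λ_{exp(tξ)} x` of a one-parameter subgroup of `U(n,n)`. -/
noncomputable def orbit (ξ : unn n) (x : Phase n) : SmoothCurve (Phase n) where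
  toFun t := Lam (expUnn (t • ξ)) x
  smooth := contDiff_emb_Lam (contDiff_expUnn_smul_mat ξ) contDiff_const

theorem orbit_zero (ξ : unn n) (x : Phase n) : (orbit ξ x).toFun 0 = x := by
  change Lam (expUnn ((0 : ℝ) • ξ)) x = x
  rw [zero_smul, expUnn_zero, Lam_one]

/-- The infinitesimal generator of the action `Λ` belonging to `ξ`, at the point `x`. -/
noncomputable def generator (ξ : unn n) (x : Phase n) : Tan x :=
  ⟨(orbit ξ x).vel 0, (congrArg Tan (orbit_zero ξ x)).le ((orbit ξ x).vel 0).2⟩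

theorem neg_gamma0_generator (ξ : unn n) (x : Phase n) :
    -gamma0 x (generator ξ x) = traceForm n (J0 x) ξ := by
  let const : SmoothCurve (Phase n) := ⟨fun _ => x, contDiff_const⟩
  have hconst : const.vel 0 = 0 := Subtype.ext (deriv_const 0 (emb x))
  have hexp : (expUnn ((0 : ℝ) • ξ))⁻¹.mat = 1 := by rw [zero_smul, expUnn_zero, inv_one]; rfl
  have h := gamma0_vel_Lam (hasDerivAt_matrix_exp_smul (ξ : Mat2 n)) (c := const)
    (c' := orbit ξ x) (G := fun t => expUnn (t • ξ)) fun _ => rfl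
  rw [oneForm_congr gamma0 (orbit_zero ξ x) (W := generator ξ x) rfl, hconst, map_zero, hexp,
    one_mul, zero_sub] at h
  rw [h, neg_neg]
  rfl

theorem isHamiltonianVector_generator (ξ : unn n) (x : Phase n) :
    IsHamiltonianVector omega (fun y => traceForm n (J0 y) ξ) x (generator ξ x) := by
  simp only [← neg_gamma0_generator]
  exact (isExteriorDerivative_omega n).isHamiltonianVector_of_invariant
    (ψ := fun s y => Lam (expUnn (s • ξ)) y) (V := generator ξ) (orbit_zero ξ)
    (fun c => contDiff_emb_Lam ((contDiff_expUnn_smul_mat ξ).comp contDiff_fst)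
      (c.smooth.comp contDiff_snd))
    (fun s c c' => gamma0_vel_Lam_const _) (fun y => (orbit ξ y).hasDerivAt 0) x

end Momentum

section LiePoisson

variable {n : ℕ}

theorem traceForm_apply (X Y : unn n) :
    traceForm n X Y = ((X : Mat2 n) * (Y : Mat2 n)).trace.re := rfl

theorem traceForm_comm (X Y : unn n) : traceForm n X Y = traceForm n Y X := by
  rw [traceForm_apply, traceForm_apply, Matrix.trace_mul_comm]

theorem traceForm_grad (f : unn n → ℝ) (X Y : unn n) :
    traceForm n (grad f X) Y = fderiv ℝ f X Y :=
  LinearMap.BilinForm.apply_toDual_symm_apply (hB := traceForm_nondegenerate n) _ _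

theorem isHamiltonianVector_comp_J0 {f : unn n → ℝ} {x : Phase n}
    (hf : DifferentiableAt ℝ f (J0 x)) {V : Tan x}
    (hV : IsHamiltonianVector omega (fun y => traceForm n (J0 y) (grad f (J0 x))) x V) :
    IsHamiltonianVector omega (f ∘ J0) x V := by
  rintro c W rfl hW
  obtain ⟨k, -, hk⟩ := exists_hasDerivAt_subtype ((c.map (isSmooth_J0 n)).hasDerivAt 0)
  have hΩ : omega _ V W = traceForm n k (grad f (J0 (c.toFun 0))) :=
    (hV c W rfl hW).unique <| hasDerivAt_isLinearMap_comp
      (L := fun X => traceForm n X (grad f (J0 (c.toFun 0)))) ((traceForm n).flip _).isLinear hk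
  rw [hΩ, traceForm_comm, traceForm_grad]
  exact hf.hasFDerivAt.comp_hasDerivAt 0 hk

theorem hasDerivAt_J0_orbit (ξ : unn n) (x : Phase n) :
    HasDerivAt (fun t => (J0 ((orbit ξ x).toFun t) : Mat2 n))
      ((ξ : Mat2 n) * (J0 x : Mat2 n) - (J0 x : Mat2 n) * (ξ : Mat2 n)) 0 := by
  have h (t : ℝ) : (J0 ((orbit ξ x).toFun t) : Mat2 n) = NormedSpace.exp (t • (ξ : Mat2 n)) *
      (J0 x : Mat2 n) * NormedSpace.exp (t • -(ξ : Mat2 n)) := by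
    rw [smul_neg]
    exact (J0_equivariant (expUnn (t • ξ)) x).symm
  simp only [h]
  refine (((hasDerivAt_matrix_exp_smul (ξ : Mat2 n)).mul_const (J0 x : Mat2 n)).mul
    (hasDerivAt_matrix_exp_smul (-(ξ : Mat2 n)))).congr_deriv ?_
  rw [zero_smul, zero_smul, NormedSpace.exp_zero, mul_one, one_mul, mul_neg, sub_eq_add_neg]

theorem omega_generator (ξ η : unn n) (x : Phase n) :
    omega x (generator ξ x) (generator η x) =
      ((J0 x : Mat2 n) * ((ξ : Mat2 n) * η - (η : Mat2 n) * ξ)).trace.re := by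
  have h := (isHamiltonianVector_generator ξ x (orbit η x) (generator η x) (orbit_zero η x)
    rfl).unique <| hasDerivAt_isLinearMap_comp isLinearMap_re_trace
      ((hasDerivAt_J0_orbit η x).mul_const (ξ : Mat2 n))
  rw [h, mul_sub, Matrix.trace_sub, sub_mul, Matrix.trace_sub, mul_assoc (η : Mat2 n),
    Matrix.trace_mul_comm (η : Mat2 n), Complex.sub_re, Complex.sub_re, mul_assoc, mul_assoc]

theorem isPoissonBracket_liePoisson {f h : unn n → ℝ} {x : Phase n}
    (hf : DifferentiableAt ℝ f (J0 x)) (hh : DifferentiableAt ℝ h (J0 x)) :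
    IsPoissonBracket omega (f ∘ J0) (h ∘ J0) x (liePoisson f h (J0 x)) :=
  ⟨generator _ x, generator _ x, isHamiltonianVector_comp_J0 hf (isHamiltonianVector_generator _ x),
    isHamiltonianVector_comp_J0 hh (isHamiltonianVector_generator _ x), omega_generator _ _ x⟩

theorem coe_ofBlocks (α δ : iH n) (β : Mat n) :
    (ofBlocks α β δ : Mat2 n) = Matrix.fromBlocks (α : Mat n) β βᴴ (δ : Mat n) := rfl

theorem trace_fromBlocks_mul (a b c d a' b' c' d' : Mat n) :
    (Matrix.fromBlocks a b c d * Matrix.fromBlocks a' b' c' d').trace =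
      (a * a' + b * c' + c * b' + d * d').trace := by
  simp only [Matrix.fromBlocks_multiply, Matrix.trace, Fintype.sum_sum_type, Matrix.diag_apply,
    Matrix.fromBlocks_apply₁₁, Matrix.fromBlocks_apply₂₂, ← Finset.sum_add_distrib,
    Matrix.add_apply, add_assoc]

theorem ofReal_traceForm_ofBlocks (α δ a d : iH n) (β b : Mat n) :
    ((traceForm n (ofBlocks α β δ) (ofBlocks a b d) : ℝ) : ℂ) =
      ((α : Mat n) * a + β * bᴴ + βᴴ * b + (δ : Mat n) * d).trace := by
  rw [traceForm_apply, ofReal_re_trace_mul_unn (ofBlocks α β δ).2 (ofBlocks a b d).2,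
    coe_ofBlocks, coe_ofBlocks, trace_fromBlocks_mul]

theorem exists_isPartials (f : unn n → ℝ) (X : unn n) :
    ∃ fα fβ fβ' fδ : Mat n, IsPartials f X fα fβ fβ' fδ := by
  obtain ⟨α, β, δ, h⟩ := exists_ofBlocks_eq (grad f X)
  refine ⟨α, β, βᴴ, δ, α.2, δ.2, rfl, fun a b d => ?_⟩
  rw [← traceForm_grad, traceForm_comm, ← h, ofReal_traceForm_ofBlocks]

theorem IsPartials.coe_grad {f : unn n → ℝ} {X : unn n} {fα fβ fβ' fδ : Mat n}
    (h : IsPartials f X fα fβ fβ' fδ) :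
    (grad f X : Mat2 n) = Matrix.fromBlocks fα fβ fβ' fδ := by
  obtain ⟨hα, hδ, rfl, hd⟩ := h
  suffices hgrad : grad f X = ofBlocks ⟨fα, hα⟩ fβ ⟨fδ, hδ⟩ by rw [hgrad]; rfl
  rw [grad, LinearEquiv.symm_apply_eq]
  refine LinearMap.ext fun Y => ?_
  obtain ⟨a, b, d, rfl⟩ := exists_ofBlocks_eq Y
  change fderiv ℝ f X (ofBlocks a b d) =
    traceForm n (ofBlocks ⟨fα, hα⟩ fβ ⟨fδ, hδ⟩) (ofBlocks a b d)
  rw [traceForm_comm, ← Complex.ofReal_inj, hd, ofReal_traceForm_ofBlocks]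

theorem ofReal_liePoisson (f h : unn n → ℝ) (α δ : iH n) (β : Mat n)
    {fα fβ fβ' fδ hα hβ hβ' hδ : Mat n} (hf : IsPartials f (ofBlocks α β δ) fα fβ fβ' fδ)
    (hh : IsPartials h (ofBlocks α β δ) hα hβ hβ' hδ) :
    ((liePoisson f h (ofBlocks α β δ) : ℝ) : ℂ) = Matrix.trace (
      (α : Mat n) * ((fα * hα - hα * fα) + fβ * hβ' - hβ * fβ') +
      β * (fβ' * hα + fδ * hβ' - hβ' * fα - hδ * fβ') +
      βᴴ * (fα * hβ + fβ * hδ - hα * fβ - hβ * fδ) +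
      (δ : Mat n) * ((fδ * hδ - hδ * fδ) + fβ' * hβ - hβ' * fβ)) := by
  rw [liePoisson, ofReal_re_trace_mul_unn (ofBlocks α β δ).2
    (commutator_mem_unn (grad f _).2 (grad h _).2), hf.coe_grad, hh.coe_grad, coe_ofBlocks,
    Matrix.fromBlocks_multiply, Matrix.fromBlocks_multiply, sub_eq_add_neg, Matrix.fromBlocks_neg,
    Matrix.fromBlocks_add, trace_fromBlocks_mul]
  congr 1
  noncomm_ring

end LiePoisson

end CotUn

theorem proposition3p2 (n : ℕ) :
    -- the identification `U(n) × iH(n) ≅ T*U(n)`, `(Z, ρ) ↦ Tr(ρ Z⁺ ·)`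
    (CotUn.IsDiffeo (CotUn.leftTriv n) ∧
      ∀ Z : CotUn.U n, ∃ L : CotUn.iH n ≃ₗ[ℝ] Module.Dual ℝ (CotUn.Tan Z),
        ∀ ρ : CotUn.iH n, CotUn.leftTriv n (Z, ρ) = ⟨Z, L ρ⟩ ∧
          ∀ v : CotUn.Tan Z, ((L ρ v : ℝ) : ℂ) =
            Matrix.trace ((ρ : CotUn.Mat n) * (Z : CotUn.Mat n)ᴴ * (v : CotUn.Mat n))) ∧
    -- (i) `I₀` is an isomorphism of vector bundles
    (CotUn.IsDiffeo (CotUn.I0base (n := n)) ∧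
      CotUn.IsDiffeo (CotUn.I0 (n := n)) ∧
      (∀ x : CotUn.Phase n, (CotUn.I0 x).proj = CotUn.I0base x.1) ∧
      ∀ Z : CotUn.U n, ∃ L : CotUn.iH n ≃ₗ[ℝ] CotUn.N0.fibre (CotUn.I0base Z),
        ∀ ρ : CotUn.iH n, (L ρ : CotUn.Mat2 n) = (CotUn.I0 (Z, ρ)).pr₁) ∧
    -- (i) `Λ` and `Σ` are actions of `U(n,n)`, and `I₀` is equivariant
    ((∀ x : CotUn.Phase n, CotUn.Lam 1 x = x) ∧
      (∀ (g h : CotUn.Unn n) (x : CotUn.Phase n),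
        CotUn.Lam (g * h) x = CotUn.Lam g (CotUn.Lam h x)) ∧
      (∀ g : CotUn.Unn n, CotUn.IsSmooth (CotUn.Lam g)) ∧
      (∀ p : CotUn.N0 n, CotUn.Sig 1 p = p) ∧
      (∀ (g h : CotUn.Unn n) (p : CotUn.N0 n),
        CotUn.Sig (g * h) p = CotUn.Sig g (CotUn.Sig h p)) ∧
      (∀ g : CotUn.Unn n, CotUn.IsSmooth (CotUn.Sig g)) ∧
      ∀ (g : CotUn.Unn n) (x : CotUn.Phase n),
        CotUn.I0 (CotUn.Lam g x) = CotUn.Sig g (CotUn.I0 x)) ∧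
    -- (ii) the canonical one-form in the coordinates `(Z, ρ)`, and its invariance under `Λ`
    ((∀ (x : CotUn.Phase n) (V : CotUn.Tan x), ((CotUn.gamma0 x V : ℝ) : ℂ) =
        Matrix.trace ((x.2 : CotUn.Mat n) * (x.1 : CotUn.Mat n)ᴴ *
          (V : CotUn.Mat n × CotUn.Mat n).1)) ∧
      (∀ c : CotUn.SmoothCurve (CotUn.Phase n), ∃ c' : CotUn.SmoothCurve (CotUn.CotU n),
        (∀ t, c'.toFun t = CotUn.leftTriv n (c.toFun t)) ∧
        CotUn.canonicalForm (c'.toFun 0) (c'.vel 0) = CotUn.gamma0 (c.toFun 0) (c.vel 0)) ∧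
      ∀ (g : CotUn.Unn n) (c : CotUn.SmoothCurve (CotUn.Phase n)),
        ∃ c' : CotUn.SmoothCurve (CotUn.Phase n),
          (∀ t, c'.toFun t = CotUn.Lam g (c.toFun t)) ∧
          CotUn.gamma0 (c'.toFun 0) (c'.vel 0) = CotUn.gamma0 (c.toFun 0) (c.vel 0)) ∧
    -- (iii) `J₀ = pr₁ ∘ I₀` is smooth and equivariant
    ((∀ x : CotUn.Phase n, (CotUn.J0 x : CotUn.Mat2 n) = (CotUn.I0 x).pr₁) ∧
      CotUn.IsSmooth (CotUn.J0 (n := n)) ∧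
      ∀ (g : CotUn.Unn n) (x : CotUn.Phase n),
        g.mat * (CotUn.J0 x : CotUn.Mat2 n) * (g⁻¹).mat = CotUn.J0 (CotUn.Lam g x)) ∧
    -- (iii) `dγ₀` is symplectic, and `J₀` is a momentum map and a Poisson map
    ((∃! Ω : ∀ x : CotUn.Phase n, CotUn.Tan x →ₗ[ℝ] CotUn.Tan x →ₗ[ℝ] ℝ,
        CotUn.IsExteriorDerivative CotUn.gamma0 Ω) ∧
      ∀ Ω : ∀ x : CotUn.Phase n, CotUn.Tan x →ₗ[ℝ] CotUn.Tan x →ₗ[ℝ] ℝ,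
        CotUn.IsExteriorDerivative CotUn.gamma0 Ω →
          (∀ x : CotUn.Phase n, (Ω x).IsAlt ∧ (Ω x).Nondegenerate) ∧
          (∀ (ξ : CotUn.unn n) (x : CotUn.Phase n),
            ∃ (c : CotUn.SmoothCurve (CotUn.Phase n)) (V : CotUn.Tan x),
              (∀ t : ℝ, c.toFun t = CotUn.Lam (CotUn.expUnn (t • ξ)) x) ∧
              (V : CotUn.Mat n × CotUn.Mat n) = c.vel 0 ∧
              CotUn.IsHamiltonianVector Ω (fun y => CotUn.traceForm n (CotUn.J0 y) ξ) x V) ∧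
          ∀ f h : CotUn.unn n → ℝ, ContDiff ℝ ∞ f → ContDiff ℝ ∞ h → ∀ x : CotUn.Phase n,
            CotUn.IsPoissonBracket Ω (f ∘ CotUn.J0) (h ∘ CotUn.J0) x
              (CotUn.liePoisson f h (CotUn.J0 x))) ∧
    -- (iii) the Lie-Poisson bracket in the block coordinates `α`, `β`, `β⁺`, `δ`
    ((∀ f : CotUn.unn n → ℝ, ContDiff ℝ ∞ f → ∀ X : CotUn.unn n,
        ∃ fα fβ fβ' fδ : CotUn.Mat n, CotUn.IsPartials f X fα fβ fβ' fδ) ∧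
      ∀ f h : CotUn.unn n → ℝ, ContDiff ℝ ∞ f → ContDiff ℝ ∞ h →
        ∀ (α δ : CotUn.iH n) (β : CotUn.Mat n)
          (fα fβ fβ' fδ hα hβ hβ' hδ : CotUn.Mat n),
          CotUn.IsPartials f (CotUn.ofBlocks α β δ) fα fβ fβ' fδ →
          CotUn.IsPartials h (CotUn.ofBlocks α β δ) hα hβ hβ' hδ →
            ((CotUn.liePoisson f h (CotUn.ofBlocks α β δ) : ℝ) : ℂ) = Matrix.trace (
              (α : CotUn.Mat n) * ((fα * hα - hα * fα) + fβ * hβ' - hβ * fβ') +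
              β * (fβ' * hα + fδ * hβ' - hβ' * fα - hδ * fβ') +
              βᴴ * (fα * hβ + fβ * hδ - hα * fβ - hβ * fδ) +
              (δ : CotUn.Mat n) * ((fδ * hδ - hδ * fδ) + fβ' * hβ - hβ' * fβ))) := by
  refine ⟨⟨CotUn.isDiffeo_leftTriv n, fun Z =>
      ⟨LinearEquiv.ofBijective _ (CotUn.leftTrivFibre_bijective Z), fun ρ =>
        ⟨rfl, fun v => CotUn.ofReal_leftPairing Z ρ v.2⟩⟩⟩,
    ⟨CotUn.isDiffeo_I0base n, CotUn.isDiffeo_I0 n, fun _ => rfl, fun Z =>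
      ⟨LinearEquiv.ofBijective _ (CotUn.I0Fibre_bijective Z), fun _ => rfl⟩⟩,
    ⟨CotUn.Lam_one, CotUn.Lam_mul, CotUn.isSmooth_Lam, CotUn.Sig_one, CotUn.Sig_mul,
      CotUn.isSmooth_Sig, CotUn.I0_Lam⟩,
    ⟨CotUn.ofReal_gamma0, CotUn.canonicalForm_leftTriv, CotUn.gamma0_invariant⟩,
    ⟨fun _ => rfl, CotUn.isSmooth_J0 n, CotUn.J0_equivariant⟩,
    ⟨⟨CotUn.omega, CotUn.isExteriorDerivative_omega n, fun _ hΩ => hΩ.eq_omega⟩, ?_⟩,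
    ⟨fun f _ X => CotUn.exists_isPartials f X,
      fun f h _ _ α δ β _ _ _ _ _ _ _ _ hf hh => CotUn.ofReal_liePoisson f h α δ β hf hh⟩⟩
  rintro Ω hΩ
  obtain rfl := hΩ.eq_omega
  exact ⟨fun x => ⟨CotUn.omega_isAlt x, CotUn.omega_nondegenerate x⟩,
    fun ξ x => ⟨CotUn.orbit ξ x, CotUn.generator ξ x, fun _ => rfl, rfl,
      CotUn.isHamiltonianVector_generator ξ x⟩,
    fun f h hf hh x => CotUn.isPoissonBracket_liePoisson
      (hf.differentiable (by simp) _) (hh.differentiable (by simp) _)⟩
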